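/- **Setting.** Let $\mathrm{Act}$ be a set of actions with an involution $a\mapsto\overline a$ (so $\overline{\overline a}=a$), and let $\tau,\checkmark\notin\mathrm{Act}$ be distinct. Put $\mathrm{Act}_\tau=\mathrm{Act}\cup\{\tau\}$. The terms of infinitary CCS are $$p ::= 1 \;\mid\; A \;\mid\; \mu.p \;\mid\; \textstyle\sum_{i\in I}p_i ,$$ with $\mu\in\mathrm{Act}_\tau$, $I$ a countable index set, and $A$ ranging over a set of constants, each with a definition $A\stackrel{\mathrm{def}}{=}p_A$. Constants can be defined freely: every countable system of equations $X_n = t_n$ ($n\in\mathbb N$), whose right-hand sides may contain existing constants and all the unknowns, is the system of definitions of some constants $A_n$, i.e. $p_{A_n}=t_n[A_m/X_m]_m$ for all $n$. Write $0$ for the empty sum. Transitions are the least relations with $1\xrightarrow{\checkmark}0$; $\mu.p\xrightarrow{\mu}p$; $\sum_i p_i\xrightarrow{\lambda}q$ if $p_i\xrightarrow{\lambda}q$ for some $i$; $A\xrightarrow{\lambda}q$ if $p_A\xrightarrow{\lambda}q$. For a countable set $X$ of terms, $\bigoplus X=\sum_{q\in X}\tau.q$. **Testing.** In $p\,\|\,r$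 each component may move alone, and $p\,\|\,r\xrightarrow{\tau}p'\,\|\,r'$ if $p\xrightarrow{a}p'$ and $r\xrightarrow{\overline a}r'$. A computation is a finite or infinite sequence of $\tau$-steps $p\,\|\,r=p_0\,\|\,r_0\xrightarrow{\tau}p_1\,\|\,r_1\xrightarrow{\tau}\cdots$; it is maximal if it is infinite or its last state has no $\tau$-step. Write $p\ \mathsf{must}\ r$ if every maximal computation from $p\,\|\,r$ contains some $r_k$ with $r_k\xrightarrow{\checkmark}$, and $p\ \mathsf{must}_{\mathrm{peer}}\ r$ if every such computation contains both some $r_k$ with $r_k\xrightarrow{\checkmark}$ and some $p_l$ with $p_l\xrightarrow{\checkmark}$. The peer preorder is: $p\sqsubseteq_{\mathrm{peer}}q$ iff for every $r$, $p\ \mathsf{must}_{\mathrm{peer}}\ r$ implies $q\ \mathsf{must}_{\mathrm{peer}}\ r$. **Traces.** For $s\in\mathrm{Act}^*$, $p\Rightarrow^s q$ means that $p$ reaches $q$ by transitions labelled in $\mathrm{Act}_\tau$ whose visible part is $s$; for $u\in\mathrm{Act}^\infty$, $p\Rightarrow^u$ means that $p$ has an infinite transition sequence whose visible part is $u$. The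 unsuccessful versions $p\Rightarrow^s_{\not\checkmark}q$ and $p\Rightarrow^u_{\not\checkmark}$ require in addition that no state of the sequence, first and last included, has a $\checkmark$-transition. Let $S(q)=\{a\in\mathrm{Act}\mid q\xrightarrow{a}\}$ and $$\mathrm{Acc}(p,s)=\{S(q)\mid p\Rightarrow^s q\not\xrightarrow{\tau}\},\qquad \mathrm{Acc}_{\not\checkmark}(p,s)=\{S(q)\mid p\Rightarrow^s_{\not\checkmark}q\not\xrightarrow{\tau}\}.$$ **Convergence and usability.** $p\Downarrow$ means that $p$ has no infinite sequence of $\tau$-transitions. $p\Downarrow\varepsilon$ iff $p\Downarrow$; $p\Downarrow as$ iff $p\Downarrow$ and, if $p\Rightarrow^a$, then $\bigoplus\{p'\mid p\Rightarrow^a p'\}\Downarrow s$. Call $r$ usable if $p\ \mathsf{must}\ r$ for some $p$. $r\ \mathrm{usbl}\ \varepsilon$ iff $r$ is usable; $r\ \mathrm{usbl}\ as$ iff $r$ is usable and, if $r\Rightarrow^a_{\not\checkmark}$, then $\bigoplus\{r'\mid r\Rightarrow^a_{\not\checkmark}r'\}\ \mathrm{usbl}\ s$. For infinite $u$, $p\Downarrow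 u$ and $r\ \mathrm{usbl}\ u$ mean that the predicate holds for every finite prefix of $u$. Let $$\mathrm{ua}(r,s)=\{a\in\mathrm{Act}\mid r\Rightarrow^{sa}_{\not\checkmark}\text{ implies }r\ \mathrm{usbl}\ sa\}.$$ **Semantic preorders.** $p\preccurlyeq_{\mathrm{clt}}q$ iff 1. for every $s\in\mathrm{Act}^*$ with $p\ \mathrm{usbl}\ s$: (a) $q\ \mathrm{usbl}\ s$, and (b) for every $B\in\mathrm{Acc}_{\not\checkmark}(q,s)$ there is $A\in\mathrm{Acc}_{\not\checkmark}(p,s)$ with $A\cap\mathrm{ua}(p,s)\subseteq B$; 2. for every $w\in\mathrm{Act}^*\cup\mathrm{Act}^\infty$ with $p\ \mathrm{usbl}\ w$: $q\Rightarrow^w_{\not\checkmark}$ implies $p\Rightarrow^w_{\not\checkmark}$. $p\preccurlyeq q$ iff 1. for every $s\in\mathrm{Act}^*$ with $p\Downarrow s$ and $p\ \mathrm{usbl}\ s$: (a) $q\Downarrow s$, and (b) for every $B\in\mathrm{Acc}(q,s)$ there is $A\in\mathrm{Acc}(p,s)$ with $A\cap\mathrm{ua}(p,s)\subseteq B$;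 2. for every $w\in\mathrm{Act}^*\cup\mathrm{Act}^\infty$ with $p\Downarrow w$ and $p\ \mathrm{usbl}\ w$: $q\Rightarrow^w$ implies $p\Rightarrow^w$. **Theorem.** For all CCS terms $p,q$: $$p\sqsubseteq_{\mathrm{peer}}q\quad\Longleftrightarrow\quad p\preccurlyeq_{\mathrm{clt}}q\ \text{ and }\ p\preccurlyeq q .$$ -/

import Mathlib

universe u

/-- The labels `μ` of prefixes: the visible actions of `Act` together with `τ`. -/
inductive Move (Act : Type*) where
  | vis (a : Act)
  | tau

/-- The labels `λ` of transitions: `Act` together with `τ` and the success label `ok`. -/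
inductive Label (Act : Type*) where
  | move (m : Move Act)
  | ok

/-- Terms of infinitary CCS, with definitional constants drawn from `K`.
Countable index sets are represented by sets of natural numbers. -/
inductive Term (Act : Type*) (K : Type*) where
  | unit
  | const (A : K)
  | pre (m : Move Act) (p : Term Act K)
  | sum (I : Set ℕ) (p : I → Term Act K)

namespace Term

/-- The empty external sum. -/
def nil {Act K : Type*} : Term Act K := sum ∅ (fun i => i.2.elim)

/-- Renaming of constants; this substitutes constants for the unknowns of a system of equations. -/
def rename {Act K L : Type*} (σ : K → L) : Term Act K → Term Act L
  | unit => unit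
  | const A => const (σ A)
  | pre m p => pre m (rename σ p)
  | sum I p => sum I (fun i => rename σ (p i))

end Term

/-- `D` assigns to each constant `A` the term `D A` that defines it. The environment is
definitionally closed if definitions can be made freely: every countable system of equations
`X n = E n`, whose right-hand sides may mention the existing constants and all the unknowns
`X 0, X 1, …`, is the system of definitions of some constants `A 0, A 1, …`. -/
def DefinitionallyClosed {Act K : Type*} (D : K → Term Act K) : Prop :=
  ∀ E : ℕ → Term Act (K ⊕ ℕ), ∃ A : ℕ → K, ∀ n, D (A n) = (E n).rename (Sum.elim id A)

/-- Constants given by a countable system of equations and a position in it. -/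
inductive FreeConst (Act : Type u) : Type u where
  | mk (E : ℕ → Term Act (FreeConst Act ⊕ ℕ)) (n : ℕ)

/-- Definitionally closed environments exist over every set of actions. -/
theorem exists_definitionallyClosed (Act : Type u) :
    ∃ (K : Type u) (D : K → Term Act K), DefinitionallyClosed D :=
  ⟨FreeConst Act, fun A => match A with
    | .mk E n => (E n).rename (Sum.elim id (FreeConst.mk E)),
   fun E => ⟨FreeConst.mk E, fun _ => rfl⟩⟩

section LTS

variable {Act : Type*} {K : Type*} (D : K → Term Act K)

/-- The operational semantics of CCS. -/
inductive Step : Term Act K → Label Act → Term Act K → Prop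
  | ok : Step .unit .ok .nil
  | pre (m : Move Act) (p : Term Act K) : Step (.pre m p) (.move m) p
  | sum (I : Set ℕ) (p : I → Term Act K) (i : I) (l : Label Act) (q : Term Act K) :
      Step (p i) l q → Step (.sum I p) l q
  | const (A : K) (l : Label Act) (q : Term Act K) : Step (D A) l q → Step (.const A) l q

/-- `p` can report success immediately. -/
def ReportsOk (p : Term Act K) : Prop := ∃ q, Step D p .ok q

/-- `p` has no internal move. -/
def Stable (p : Term Act K) : Prop := ¬ ∃ q, Step D p (.move .tau) q

/-- The ready set `S(p)`. -/
def ready (p : Term Act K) : Set Act := {a | ∃ q, Step D p (.move (.vis a)) q}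

/-- Weak transitions along a finite trace of visible actions. -/
inductive Weak : Term Act K → List Act → Term Act K → Prop
  | refl (p : Term Act K) : Weak p [] p
  | vis (p p₁ q : Term Act K) (a : Act) (s : List Act) :
      Step D p (.move (.vis a)) p₁ → Weak p₁ s q → Weak p (a :: s) q
  | tau (p p₁ q : Term Act K) (s : List Act) :
      Step D p (.move .tau) p₁ → Weak p₁ s q → Weak p s q

/-- Unsuccessful weak transitions: no state on the way, the first and the last included,
can report success. -/
inductive UWeak : Term Act K → List Act → Term Act K → Prop
  | refl (p : Term Act K) : ¬ ReportsOk D p → UWeak p [] p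
  | vis (p p₁ q : Term Act K) (a : Act) (s : List Act) : ¬ ReportsOk D p →
      Step D p (.move (.vis a)) p₁ → UWeak p₁ s q → UWeak p (a :: s) q
  | tau (p p₁ q : Term Act K) (s : List Act) : ¬ ReportsOk D p →
      Step D p (.move .tau) p₁ → UWeak p₁ s q → UWeak p s q

/-- The string of visible actions in a string of moves. -/
def visible (t : List (Move Act)) : List Act :=
  t.filterMap fun m => match m with
    | .vis a => some a
    | .tau => none

/-- The prefix of length `n` of an infinite sequence. -/
def initSeg {α : Type*} (u : ℕ → α) (n : ℕ) : List α := (List.range n).map u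

/-- `f` is an infinite sequence of transitions from `p`, with labels `t`, that performs the
infinite visible trace `u`. -/
def IsInfRun (p : Term Act K) (u : ℕ → Act) (f : ℕ → Term Act K) (t : ℕ → Move Act) : Prop :=
  f 0 = p ∧ (∀ n, Step D (f n) (.move (t n)) (f (n + 1))) ∧
    ∀ n, ∃ k, initSeg u n = visible (initSeg t k)

/-- Weak transitions along an infinite trace. -/
def InfWeak (p : Term Act K) (u : ℕ → Act) : Prop := ∃ f t, IsInfRun D p u f t

/-- Unsuccessful weak transitions along an infinite trace. -/
def InfUWeak (p : Term Act K) (u : ℕ → Act) : Prop :=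
  ∃ f t, IsInfRun D p u f t ∧ ∀ n, ¬ ReportsOk D (f n)

/-- The residuals of `p` after `s`. -/
def after (p : Term Act K) (s : List Act) : Set (Term Act K) := {q | Weak D p s q}

/-- The residuals of `p` after performing `s` unsuccessfully. -/
def afterU (p : Term Act K) (s : List Act) : Set (Term Act K) := {q | UWeak D p s q}

/-- The acceptance set of `p` after `s`. -/
def acc (p : Term Act K) (s : List Act) : Set (Set Act) :=
  {B | ∃ q, Weak D p s q ∧ Stable D q ∧ B = ready D q}

/-- The unsuccessful acceptance set of `p` after `s`. -/
def accU (p : Term Act K) (s : List Act) : Set (Set Act) :=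
  {B | ∃ q, UWeak D p s q ∧ Stable D q ∧ B = ready D q}

/-- The transitions of a term with a derivation of depth at most `n`. -/
def transitionsUpTo : ℕ → Term Act K → Set (Label Act × Term Act K)
  | 0, _ => ∅
  | _ + 1, .unit => {(.ok, .nil)}
  | n + 1, .const A => transitionsUpTo n (D A)
  | _ + 1, .pre m p => {(.move m, p)}
  | n + 1, .sum _ p => ⋃ i, transitionsUpTo n (p i)

theorem transitionsUpTo_countable (n : ℕ) (p : Term Act K) :
    (transitionsUpTo D n p).Countable := by
  induction n generalizing p with
  | zero => simp [transitionsUpTo]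
  | succ n ih =>
    cases p with
    | unit => simp [transitionsUpTo]
    | const A => simpa [transitionsUpTo] using ih (D A)
    | pre m p => simp [transitionsUpTo]
    | sum I p =>
      simp only [transitionsUpTo]
      exact Set.countable_iUnion fun i => ih (p i)

theorem Step.exists_mem_transitionsUpTo {p q : Term Act K} {l : Label Act} (h : Step D p l q) :
    ∃ n, (l, q) ∈ transitionsUpTo D n p := by
  induction h with
  | ok => exact ⟨1, by simp [transitionsUpTo]⟩
  | pre m p => exact ⟨1, by simp [transitionsUpTo]⟩
  | sum I p i l q _ ih =>
    obtain ⟨n, hn⟩ := ih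
    exact ⟨n + 1, by simp only [transitionsUpTo, Set.mem_iUnion]; exact ⟨i, hn⟩⟩
  | const A l q _ ih =>
    obtain ⟨n, hn⟩ := ih
    exact ⟨n + 1, by simpa only [transitionsUpTo] using hn⟩

theorem successors_countable (p : Term Act K) : {q | ∃ l, Step D p l q}.Countable := by
  refine Set.Countable.mono ?_
    ((Set.countable_iUnion fun n => transitionsUpTo_countable D n p).image Prod.snd)
  rintro q ⟨l, h⟩
  obtain ⟨n, hn⟩ := h.exists_mem_transitionsUpTo
  exact ⟨(l, q), Set.mem_iUnion.2 ⟨n, hn⟩, rfl⟩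

/-- The terms that can be reached from `p` in `n` transitions. -/
def reachIn : ℕ → Term Act K → Set (Term Act K)
  | 0, p => {p}
  | n + 1, p => ⋃ p₁ ∈ {q | ∃ l, Step D p l q}, reachIn n p₁

theorem reachIn_countable (n : ℕ) (p : Term Act K) : (reachIn D n p).Countable := by
  induction n generalizing p with
  | zero => simp [reachIn]
  | succ n ih =>
    simp only [reachIn]
    exact (successors_countable D p).biUnion fun p₁ _ => ih p₁

theorem mem_reachIn_succ {p p₁ q : Term Act K} {l : Label Act} {n : ℕ} (h : Step D p l p₁)
    (hq : q ∈ reachIn D n p₁) : q ∈ reachIn D (n + 1) p := by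
  simp only [reachIn, Set.mem_iUnion]
  exact ⟨p₁, ⟨l, h⟩, hq⟩

theorem after_countable (p : Term Act K) (s : List Act) : (after D p s).Countable := by
  refine Set.Countable.mono ?_ (Set.countable_iUnion fun n => reachIn_countable D n p)
  intro q hq
  simp only [Set.mem_iUnion]
  induction (show Weak D p s q from hq) with
  | refl p => exact ⟨0, by simp [reachIn]⟩
  | vis p p₁ q a s h hw ih =>
    obtain ⟨n, hn⟩ := ih hw
    exact ⟨n + 1, mem_reachIn_succ D h hn⟩
  | tau p p₁ q s h hw ih =>
    obtain ⟨n, hn⟩ := ih hw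
    exact ⟨n + 1, mem_reachIn_succ D h hn⟩

theorem UWeak.weak {p q : Term Act K} {s : List Act} (h : UWeak D p s q) : Weak D p s q := by
  induction h with
  | refl p _ => exact .refl p
  | vis p p₁ q a s _ h _ ih => exact .vis p p₁ q a s h ih
  | tau p p₁ q s _ h _ ih => exact .tau p p₁ q s h ih

theorem afterU_countable (p : Term Act K) (s : List Act) : (afterU D p s).Countable :=
  (after_countable D p s).mono fun _ h => UWeak.weak D h

/-- The internal sum of a countable set of terms `X`: the external sum of all `τ.q` with
`q ∈ X`, indexed through some injection of `X` into the natural numbers. -/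
noncomputable def intSum (X : Set (Term Act K)) (hX : X.Countable) : Term Act K :=
  let g := (Set.countable_iff_exists_injective.1 hX).choose
  .sum (Set.range g) fun i => .pre .tau (i.2.choose : X)

theorem step_intSum_iff (X : Set (Term Act K)) (hX : X.Countable) (l : Label Act)
    (q : Term Act K) : Step D (intSum X hX) l q ↔ l = .move .tau ∧ q ∈ X := by
  constructor
  · intro h
    unfold intSum at h
    cases h with
    | sum _ _ i _ _ h =>
      cases h with
      | pre _ _ => exact ⟨rfl, Subtype.coe_prop _⟩
  · rintro ⟨rfl, hq⟩
    unfold intSum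
    generalize_proofs pg
    have hm : ∃ y, pg.choose y = pg.choose ⟨q, hq⟩ := ⟨⟨q, hq⟩, rfl⟩
    refine .sum _ _ ⟨pg.choose ⟨q, hq⟩, hm⟩ _ _ ?_
    have hc : hm.choose = ⟨q, hq⟩ := pg.choose_spec hm.choose_spec
    simp only [hc]
    exact .pre _ _

/-- `p` converges: there is no infinite sequence of internal moves from `p`. -/
def Converges (p : Term Act K) : Prop :=
  ¬ ∃ f : ℕ → Term Act K, f 0 = p ∧ ∀ n, Step D (f n) (.move .tau) (f (n + 1))

/-- Convergence along a finite trace. -/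
def ConvAlong : Term Act K → List Act → Prop
  | p, [] => Converges D p
  | p, a :: s => Converges D p ∧
      ((∃ q, Weak D p [a] q) → ConvAlong (intSum (after D p [a]) (after_countable D p [a])) s)

/-- Convergence along an infinite trace. -/
def InfConvAlong (p : Term Act K) (u : ℕ → Act) : Prop := ∀ n, ConvAlong D p (initSeg u n)

variable (co : Act → Act)

/-- The operational semantics of the composition of two processes. -/
inductive ParStep : Term Act K × Term Act K → Label Act → Term Act K × Term Act K → Prop
  | left (q q₁ p : Term Act K) (l : Label Act) : Step D q l q₁ → ParStep (q, p) l (q₁, p)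
  | right (q p p₁ : Term Act K) (l : Label Act) : Step D p l p₁ → ParStep (q, p) l (q, p₁)
  | synch (q q₁ p p₁ : Term Act K) (a : Act) : Step D q (.move (.vis a)) q₁ →
      Step D p (.move (.vis (co a))) p₁ → ParStep (q, p) (.move .tau) (q₁, p₁)

/-- `f 0, f 1, …, f N` (or the whole sequence `f` if `N = ⊤`) is a maximal computation from
the composition of `p` and `r`. The values of `f` beyond `N` are irrelevant. -/
def IsMaxComputation (p r : Term Act K) (N : ℕ∞) (f : ℕ → Term Act K × Term Act K) : Prop :=
  f 0 = (p, r) ∧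
  (∀ n : ℕ, (n : ℕ∞) < N → ParStep D co (f n) (.move .tau) (f (n + 1))) ∧
  (∀ n : ℕ, (n : ℕ∞) = N → ¬ ∃ c, ParStep D co (f n) (.move .tau) c)

/-- `p` must satisfy the client `r`: every maximal computation is client-successful. -/
def Must (p r : Term Act K) : Prop :=
  ∀ N f, IsMaxComputation D co p r N f → ∃ k : ℕ, (k : ℕ∞) ≤ N ∧ ReportsOk D (f k).2

/-- `p` and `r` must satisfy each other: every maximal computation is successful. -/
def MustPeer (p r : Term Act K) : Prop :=
  ∀ N f, IsMaxComputation D co p r N f →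
    (∃ k : ℕ, (k : ℕ∞) ≤ N ∧ ReportsOk D (f k).2) ∧
    (∃ l : ℕ, (l : ℕ∞) ≤ N ∧ ReportsOk D (f l).1)

/-- The peer preorder. -/
def PeerLE (p q : Term Act K) : Prop := ∀ r, MustPeer D co p r → MustPeer D co q r

/-- The usable clients. -/
def Usable (r : Term Act K) : Prop := ∃ p, Must D co p r

/-- Client usability along a finite unsuccessful trace. -/
def UsableAlong : Term Act K → List Act → Prop
  | r, [] => Usable D co r
  | r, a :: s => Usable D co r ∧
      ((∃ q, UWeak D r [a] q) →
        UsableAlong (intSum (afterU D r [a]) (afterU_countable D r [a])) s)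

/-- Client usability along an infinite unsuccessful trace. -/
def InfUsableAlong (r : Term Act K) (u : ℕ → Act) : Prop :=
  ∀ n, UsableAlong D co r (initSeg u n)

/-- The usable actions of a client `r` after the trace `s`. -/
def usableActions (r : Term Act K) (s : List Act) : Set Act :=
  {a | (∃ q, UWeak D r (s ++ [a]) q) → UsableAlong D co r (s ++ [a])}

/-- The semantic client preorder. -/
structure SemClientLE (r₁ r₂ : Term Act K) : Prop where
  usable : ∀ s, UsableAlong D co r₁ s → UsableAlong D co r₂ s
  accept : ∀ s, UsableAlong D co r₁ s → ∀ B ∈ accU D r₂ s,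
    ∃ A ∈ accU D r₁ s, A ∩ usableActions D co r₁ s ⊆ B
  finTrace : ∀ s, UsableAlong D co r₁ s → (∃ q, UWeak D r₂ s q) → ∃ q, UWeak D r₁ s q
  infTrace : ∀ u, InfUsableAlong D co r₁ u → InfUWeak D r₂ u → InfUWeak D r₁ u

/-- Peer convergence along a finite trace. -/
def PeerConvAlong (p : Term Act K) (s : List Act) : Prop :=
  ConvAlong D p s ∧ UsableAlong D co p s

/-- Peer convergence along an infinite trace. -/
def InfPeerConvAlong (p : Term Act K) (u : ℕ → Act) : Prop :=
  InfConvAlong D p u ∧ InfUsableAlong D co p u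

/-- The server-like preorder relativised to client usability. -/
structure SemUsableServerLE (p q : Term Act K) : Prop where
  conv : ∀ s, PeerConvAlong D co p s → ConvAlong D q s
  accept : ∀ s, PeerConvAlong D co p s → ∀ B ∈ acc D q s,
    ∃ A ∈ acc D p s, A ∩ usableActions D co p s ⊆ B
  finTrace : ∀ s, PeerConvAlong D co p s → (∃ q₁, Weak D q s q₁) → ∃ p₁, Weak D p s p₁
  infTrace : ∀ u, InfPeerConvAlong D co p u → InfWeak D q u → InfWeak D p u

/-- The semantic peer preorder. -/
def SemPeerLE (p q : Term Act K) : Prop := SemClientLE D co p q ∧ SemUsableServerLE D co p q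

end LTS

/-! Since `co` is an involution, peer testing splits into two must tests, one for each component as
the client (`mustPeer_iff`). Must is replaced by the well-founded `MustWf`, which supports
induction. The trace predicates unfold: usability along `s` means that, for each prefix, one server
satisfies all unsuccessful residuals (`usableAlong_iff`); convergence means that all residuals
converge (`convAlong_iff`).

Soundness: a failing computation unzips into complementary traces that end in a divergence of one
side or in a deadlock, or into two complementary infinite runs (`unzip`). If a test serves `p`, its
residuals witness that `p` is usable along every trace it follows, so the semantic clauses apply;
they either exclude the failure of `q` outright or reproduce it for `p`. Such a test can only
synchronize on usable actions, which is why ready sets of `p` need comparing on `usableActions`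
only.

Completeness: a test follows a trace in stages, each of which performs the next complementary action
or retreats by `τ` to `1 + r`, where `r` serves all unsuccessful residuals of `p` at that point and
exists by usability. The retreat succeeds at once as a client and still serves `p`, so retreating is
harmless in both roles. What ends the trace (`exists_test`) exposes the violated clause: a loop, an
offer of usable actions (`exists_offer`), or `τ.(1 + r)`; infinite traces use an infinite chain of
stages (`exists_infTest`). -/

section PeerTesting

variable {Act : Type*} {K : Type*} {D : K → Term Act K} {co : Act → Act}

/-! ### Weak transitions through states satisfying a predicate -/

/-- Weak transitions along a finite trace, all of whose states satisfy `G`. -/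
inductive GuardedWeak (D : K → Term Act K) (G : Term Act K → Prop) :
    Term Act K → List Act → Term Act K → Prop
  | refl {p : Term Act K} : G p → GuardedWeak D G p [] p
  | vis {p p₁ q : Term Act K} {a : Act} {s : List Act} : G p →
      Step D p (.move (.vis a)) p₁ → GuardedWeak D G p₁ s q → GuardedWeak D G p (a :: s) q
  | tau {p p₁ q : Term Act K} {s : List Act} : G p →
      Step D p (.move .tau) p₁ → GuardedWeak D G p₁ s q → GuardedWeak D G p s q

/-- The states that cannot report success. -/
def NotOk (D : K → Term Act K) (p : Term Act K) : Prop := ¬ ReportsOk D p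

theorem weak_iff_guardedWeak {p q : Term Act K} {s : List Act} :
    Weak D p s q ↔ GuardedWeak D (fun _ => True) p s q := by
  constructor <;> intro h
  · induction h with
    | refl p => exact .refl trivial
    | vis p p₁ q a s h _ ih => exact .vis trivial h ih
    | tau p p₁ q s h _ ih => exact .tau trivial h ih
  · induction h with
    | refl _ => exact .refl _
    | vis _ h _ ih => exact .vis _ _ _ _ _ h ih
    | tau _ h _ ih => exact .tau _ _ _ _ h ih

theorem uWeak_iff_guardedWeak {p q : Term Act K} {s : List Act} :
    UWeak D p s q ↔ GuardedWeak D (NotOk D) p s q := by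
  constructor <;> intro h
  · induction h with
    | refl p hp => exact .refl hp
    | vis p p₁ q a s hp h _ ih => exact .vis hp h ih
    | tau p p₁ q s hp h _ ih => exact .tau hp h ih
  · induction h with
    | refl hp => exact .refl _ hp
    | vis hp h _ ih => exact .vis _ _ _ _ _ hp h ih
    | tau hp h _ ih => exact .tau _ _ _ _ hp h ih

namespace GuardedWeak

variable {G : Term Act K → Prop} {p q m : Term Act K} {s t : List Act}

theorem left_mem (h : GuardedWeak D G p s q) : G p := by
  cases h <;> assumption

theorem right_mem (h : GuardedWeak D G p s q) : G q := by
  induction h <;> assumption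

theorem forget (h : GuardedWeak D G p s q) : GuardedWeak D (fun _ => True) p s q := by
  induction h with
  | refl _ => exact .refl trivial
  | vis _ h _ ih => exact .vis trivial h ih
  | tau _ h _ ih => exact .tau trivial h ih

theorem append (h : GuardedWeak D G p s m) (h' : GuardedWeak D G m t q) :
    GuardedWeak D G p (s ++ t) q := by
  induction h with
  | refl _ => exact h'
  | vis hp h _ ih => exact .vis hp h (ih h')
  | tau hp h _ ih => exact .tau hp h (ih h')

theorem exists_of_append (h : GuardedWeak D G p (s ++ t) q) :
    ∃ m, GuardedWeak D G p s m ∧ GuardedWeak D G m t q := by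
  generalize hw : s ++ t = w at h
  induction h generalizing s with
  | refl hp =>
    obtain ⟨rfl, rfl⟩ := List.append_eq_nil_iff.1 hw
    exact ⟨_, .refl hp, .refl hp⟩
  | @vis p p₁ q a w hp h hq ih =>
    cases s with
    | nil => subst hw; exact ⟨p, .refl hp, .vis hp h hq⟩
    | cons b s =>
      obtain ⟨rfl, hw'⟩ := List.cons.inj hw
      obtain ⟨m, h₁, h₂⟩ := ih hw'
      exact ⟨m, .vis hp h h₁, h₂⟩
  | tau hp h hq ih =>
    obtain ⟨m, h₁, h₂⟩ := ih hw
    exact ⟨m, .tau hp h h₁, h₂⟩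

theorem exists_of_prefix (h : GuardedWeak D G p t q) (hs : s <+: t) :
    ∃ m, GuardedWeak D G p s m := by
  obtain ⟨w, rfl⟩ := hs
  obtain ⟨m, h, -⟩ := h.exists_of_append
  exact ⟨m, h⟩

end GuardedWeak

theorem guardedWeak_intSum_iff {G : Term Act K → Prop} {X : Set (Term Act K)} {hX : X.Countable}
    (hG : G (intSum X hX)) {s : List Act} {q : Term Act K} :
    GuardedWeak D G (intSum X hX) s q ↔
      (s = [] ∧ q = intSum X hX) ∨ ∃ x ∈ X, GuardedWeak D G x s q := by
  constructor
  · intro h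
    cases h with
    | refl _ => exact .inl ⟨rfl, rfl⟩
    | vis _ h _ => simp [step_intSum_iff] at h
    | tau _ h hq =>
      rw [step_intSum_iff] at h
      exact .inr ⟨_, h.2, hq⟩
  · rintro (⟨rfl, rfl⟩ | ⟨x, hx, h⟩)
    · exact .refl hG
    · exact .tau hG ((step_intSum_iff D X hX _ _).2 ⟨rfl, hx⟩) h

theorem notOk_intSum (X : Set (Term Act K)) (hX : X.Countable) : NotOk D (intSum X hX) := by
  rintro ⟨q, h⟩
  simp [step_intSum_iff] at h

/-! ### Infinite runs -/

theorem initSeg_succ {α : Type*} (u : ℕ → α) (n : ℕ) :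
    initSeg u (n + 1) = initSeg u n ++ [u n] := by
  simp [initSeg, List.range_succ]

theorem initSeg_succ' {α : Type*} (u : ℕ → α) (n : ℕ) :
    initSeg u (n + 1) = u 0 :: initSeg (fun k => u (k + 1)) n := by
  simp [initSeg, List.range_succ_eq_map, Function.comp_def]

theorem map_initSeg {α β : Type*} (g : α → β) (u : ℕ → α) (n : ℕ) :
    (initSeg u n).map g = initSeg (fun k => g (u k)) n := by
  simp [initSeg, Function.comp_def]

/-- Infinite runs through states satisfying `G`. -/
def GuardedInfWeak (D : K → Term Act K) (G : Term Act K → Prop) (p : Term Act K)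
    (u : ℕ → Act) : Prop :=
  ∃ f t, IsInfRun D p u f t ∧ ∀ n, G (f n)

theorem infWeak_iff_guardedInfWeak {p : Term Act K} {u : ℕ → Act} :
    InfWeak D p u ↔ GuardedInfWeak D (fun _ => True) p u := by
  simp [InfWeak, GuardedInfWeak]

theorem GuardedInfWeak.exists_initSeg {G : Term Act K → Prop} {p : Term Act K} {u : ℕ → Act}
    (h : GuardedInfWeak D G p u) (n : ℕ) : ∃ q, GuardedWeak D G p (initSeg u n) q := by
  obtain ⟨f, t, ⟨rfl, hs, hu⟩, hG⟩ := h
  have key : ∀ k, GuardedWeak D G (f 0) (visible (initSeg t k)) (f k) := by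
    intro k
    induction k with
    | zero => exact .refl (hG 0)
    | succ k ih =>
      rw [initSeg_succ, visible, List.filterMap_append]
      refine ih.append ?_
      have hk := hs k
      cases htk : t k with
      | vis a => rw [htk] at hk; exact .vis (hG k) hk (.refl (hG _))
      | tau => rw [htk] at hk; exact .tau (hG k) hk (.refl (hG _))
  obtain ⟨k, hk⟩ := hu n
  exact ⟨f k, hk ▸ key k⟩

theorem GuardedInfWeak.step {G : Term Act K → Prop} {p : Term Act K} {u : ℕ → Act}
    (h : GuardedInfWeak D G p u) :
    G p ∧ ((∃ p₁, Step D p (.move .tau) p₁ ∧ GuardedInfWeak D G p₁ u) ∨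
      ∃ p₁, Step D p (.move (.vis (u 0))) p₁ ∧ GuardedInfWeak D G p₁ fun k => u (k + 1)) := by
  obtain ⟨f, t, ⟨rfl, hs, hu⟩, hG⟩ := h
  refine ⟨hG 0, ?_⟩
  have h0 := hs 0
  cases ht : t 0 with
  | tau =>
    rw [ht] at h0
    refine .inl ⟨f 1, h0, fun n => f (n + 1), fun n => t (n + 1),
      ⟨rfl, fun n => hs (n + 1), fun n => ?_⟩, fun n => hG (n + 1)⟩
    obtain ⟨k, hk⟩ := hu n
    cases k with
    | zero => exact ⟨0, hk⟩
    | succ k =>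
      refine ⟨k, ?_⟩
      rw [hk, initSeg_succ', ht]
      rfl
  | vis a =>
    rw [ht] at h0
    -- Asking for `n + 1` visible actions rules out the empty prefix of `t`, so the first move `a`
    -- must be `u 0`.
    have hcons : ∀ n, ∃ k, u 0 :: initSeg (fun k => u (k + 1)) n =
        a :: visible (initSeg (fun k => t (k + 1)) k) := by
      intro n
      obtain ⟨k, hk⟩ := hu (n + 1)
      rw [initSeg_succ'] at hk
      cases k with
      | zero => simp [initSeg, visible] at hk
      | succ k =>
        rw [initSeg_succ' t, ht] at hk
        exact ⟨k, hk⟩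
    obtain rfl : u 0 = a := (List.cons.inj (hcons 0).choose_spec).1
    refine .inr ⟨f 1, h0, fun n => f (n + 1), fun n => t (n + 1),
      ⟨rfl, fun n => hs (n + 1), fun n => ?_⟩, fun n => hG (n + 1)⟩
    obtain ⟨k, hk⟩ := hcons n
    exact ⟨k, (List.cons.inj hk).2⟩

/-- Guarded weak transitions of a given length. -/
def GuardedPath (D : K → Term Act K) (G : Term Act K → Prop) :
    ℕ → Term Act K → List Act → Term Act K → Prop
  | 0, p, s, q => G p ∧ s = [] ∧ p = q
  | n + 1, p, s, q => G p ∧ ∃ p₁, (Step D p (.move .tau) p₁ ∧ GuardedPath D G n p₁ s q) ∨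
      ∃ a s₁, s = a :: s₁ ∧ Step D p (.move (.vis a)) p₁ ∧ GuardedPath D G n p₁ s₁ q

theorem guardedWeak_iff_exists_path {G : Term Act K → Prop} {p q : Term Act K} {s : List Act} :
    GuardedWeak D G p s q ↔ ∃ n, GuardedPath D G n p s q := by
  constructor
  · intro h
    induction h with
    | refl hp => exact ⟨0, hp, rfl, rfl⟩
    | vis hp h _ ih =>
      obtain ⟨n, hn⟩ := ih
      exact ⟨n + 1, hp, _, .inr ⟨_, _, rfl, h, hn⟩⟩
    | tau hp h _ ih =>
      obtain ⟨n, hn⟩ := ih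
      exact ⟨n + 1, hp, _, .inl ⟨h, hn⟩⟩
  · rintro ⟨n, hn⟩
    induction n generalizing p s with
    | zero => obtain ⟨hp, rfl, rfl⟩ := hn; exact .refl hp
    | succ n ih =>
      obtain ⟨hp, p₁, ⟨h, hn⟩ | ⟨a, s₁, rfl, h, hn⟩⟩ := hn
      · exact .tau hp h (ih hn)
      · exact .vis hp h (ih hn)

/-- Infinitely many weak transitions compose to an infinite run. -/
theorem guardedInfWeak_of_seq {G : Term Act K → Prop} {u : ℕ → Act} {g : ℕ → Term Act K}
    (hg : ∀ n, GuardedWeak D G (g n) [u n] (g (n + 1))) : GuardedInfWeak D G (g 0) u := by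
  -- A configuration holds the current term, the index of the current segment, and the number of
  -- transitions left to the end of that segment.
  let Inv : Term Act K × ℕ × ℕ → Prop := fun c =>
    GuardedPath D G c.2.2 c.1 [u c.2.1] (g (c.2.1 + 1))
  have hstep : ∀ c : {c // Inv c}, ∃ (m : Move Act) (c' : {c // Inv c}),
      Step D c.1.1 (.move m) c'.1.1 ∧
      ((m = .tau ∧ c'.1.2.1 = c.1.2.1 ∧ c'.1.2.2 < c.1.2.2) ∨
        (m = .vis (u c.1.2.1) ∧ c'.1.2.1 = c.1.2.1 + 1)) := by
    rintro ⟨⟨x, j, k⟩, hc⟩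
    cases k with
    | zero => simp [Inv, GuardedPath] at hc
    | succ k =>
      obtain ⟨hx, x₁, ⟨h, hk⟩ | ⟨a, s₁, hs, h, hk⟩⟩ := hc
      · exact ⟨.tau, ⟨(x₁, j, k), hk⟩, h, .inl ⟨rfl, rfl, Nat.lt_succ_self k⟩⟩
      · obtain ⟨rfl, rfl⟩ := List.cons.inj hs
        -- After the visible action the rest of the segment is silent; it is glued to the front of
        -- the next segment.
        obtain ⟨k', hk'⟩ := guardedWeak_iff_exists_path.1
          ((guardedWeak_iff_exists_path.2 ⟨k, hk⟩).append (hg (j + 1)))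
        exact ⟨.vis (u j), ⟨(x₁, j + 1, k'), hk'⟩, h, .inr ⟨rfl, rfl⟩⟩
  choose m nx hm hnx using hstep
  obtain ⟨k₀, hk₀⟩ := guardedWeak_iff_exists_path.1 (hg 0)
  let c : ℕ → {c // Inv c} := fun n => Nat.rec ⟨(g 0, 0, k₀), hk₀⟩ (fun _ c => nx c) n
  have hvis : ∀ k, initSeg u (c k).1.2.1 = visible (initSeg (fun n => m (c n)) k) := by
    intro k
    induction k with
    | zero => rfl
    | succ k ih =>
      rw [initSeg_succ, visible, List.filterMap_append]
      change initSeg u (nx (c k)).1.2.1 = visible _ ++ _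
      rcases hnx (c k) with ⟨h, h', -⟩ | ⟨h, h'⟩
      · rw [h', ih, h]; simp
      · rw [h', initSeg_succ, ih, h]; simp
  -- Silent moves shorten the remaining path, so each segment reaches its visible action.
  have hprog : ∀ b i, (c i).1.2.2 = b → ∃ i', (c i').1.2.1 = (c i).1.2.1 + 1 := by
    intro b
    induction b using Nat.strong_induction_on with
    | _ b ih =>
      intro i hi
      rcases hnx (c i) with ⟨-, h', hlt⟩ | ⟨-, h'⟩
      · obtain ⟨i', hi'⟩ := ih _ (hi ▸ hlt) (i + 1) rfl
        exact ⟨i', hi'.trans (congrArg (· + 1) h')⟩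
      · exact ⟨i + 1, h'⟩
  have hsurj : ∀ n, ∃ k, (c k).1.2.1 = n := by
    intro n
    induction n with
    | zero => exact ⟨0, rfl⟩
    | succ n ih =>
      obtain ⟨k, rfl⟩ := ih
      exact hprog _ k rfl
  refine ⟨fun n => (c n).1.1, fun n => m (c n), ⟨rfl, fun n => hm (c n), fun n => ?_⟩, fun n => ?_⟩
  · obtain ⟨k, rfl⟩ := hsurj n
    exact ⟨k, hvis k⟩
  · exact (guardedWeak_iff_exists_path.2 ⟨_, (c n).2⟩).left_mem

/-! ### Must testing as an inductive predicate -/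

/-- The inductive characterization of `Must`. -/
inductive MustWf (D : K → Term Act K) (co : Act → Act) : Term Act K → Term Act K → Prop
  | ok {p r : Term Act K} : ReportsOk D r → MustWf D co p r
  | step {p r : Term Act K} :
      (∃ p₁ r₁, ParStep D co (p, r) (.move .tau) (p₁, r₁)) →
      (∀ p₁ r₁, ParStep D co (p, r) (.move .tau) (p₁, r₁) → MustWf D co p₁ r₁) → MustWf D co p r

theorem parStep_tau_iff {p r p₁ r₁ : Term Act K} :
    ParStep D co (p, r) (.move .tau) (p₁, r₁) ↔
      (Step D p (.move .tau) p₁ ∧ r₁ = r) ∨ (p₁ = p ∧ Step D r (.move .tau) r₁) ∨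
      ∃ a, Step D p (.move (.vis a)) p₁ ∧ Step D r (.move (.vis (co a))) r₁ := by
  constructor
  · intro h
    cases h with
    | left _ _ _ _ h => exact .inl ⟨h, rfl⟩
    | right _ _ _ _ h => exact .inr (.inl ⟨rfl, h⟩)
    | synch _ _ _ _ a h h' => exact .inr (.inr ⟨a, h, h'⟩)
  · rintro (⟨h, rfl⟩ | ⟨rfl, h⟩ | ⟨a, h, h'⟩)
    · exact .left _ _ _ _ h
    · exact .right _ _ _ _ h
    · exact .synch _ _ _ _ a h h'

/-- Case-split form of `MustWf.step`. -/
theorem MustWf.intro {p r : Term Act K}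
    (hex : ∃ p₁ r₁, ParStep D co (p, r) (.move .tau) (p₁, r₁))
    (hl : ∀ p₁, Step D p (.move .tau) p₁ → MustWf D co p₁ r)
    (hr : ∀ r₁, Step D r (.move .tau) r₁ → MustWf D co p r₁)
    (hs : ∀ a p₁ r₁, Step D p (.move (.vis a)) p₁ → Step D r (.move (.vis (co a))) r₁ →
      MustWf D co p₁ r₁) : MustWf D co p r := by
  refine .step hex fun p₁ r₁ h => ?_
  rcases parStep_tau_iff.1 h with ⟨h₁, rfl⟩ | ⟨rfl, h₁⟩ | ⟨a, h₁, h₂⟩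
  exacts [hl _ h₁, hr _ h₁, hs a _ _ h₁ h₂]

theorem MustWf.of_step {p r p₁ r₁ : Term Act K} (h : MustWf D co p r) (hr : NotOk D r)
    (hs : ParStep D co (p, r) (.move .tau) (p₁, r₁)) : MustWf D co p₁ r₁ := by
  cases h with
  | ok h => exact absurd h hr
  | step _ h => exact h _ _ hs

theorem MustWf.exists_step {p r : Term Act K} (h : MustWf D co p r) (hr : NotOk D r) :
    ∃ p₁ r₁, ParStep D co (p, r) (.move .tau) (p₁, r₁) := by
  cases h with
  | ok h => exact absurd h hr
  | step h _ => exact h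

theorem exists_parStep_of_not_mustWf {p r : Term Act K} (h : ¬ MustWf D co p r)
    (hex : ∃ p₁ r₁, ParStep D co (p, r) (.move .tau) (p₁, r₁)) :
    ∃ p₁ r₁, ParStep D co (p, r) (.move .tau) (p₁, r₁) ∧ ¬ MustWf D co p₁ r₁ := by
  by_contra! hc
  exact h (.step hex hc)

theorem notOk_of_not_mustWf {p r : Term Act K} (h : ¬ MustWf D co p r) : NotOk D r :=
  fun hr => h (.ok hr)

theorem MustWf.must {p r : Term Act K} (h : MustWf D co p r) : Must D co p r := by
  rintro N f ⟨h0, hs, hmax⟩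
  suffices ∀ n : ℕ, (n : ℕ∞) ≤ N → f n = (p, r) → ∃ k : ℕ, (k : ℕ∞) ≤ N ∧ ReportsOk D (f k).2 from
    this 0 (by simp) h0
  clear h0
  induction h with
  | ok h => exact fun n hn hf => ⟨n, hn, by rw [hf]; exact h⟩
  | step hex _ ih =>
    intro n hn hf
    rcases hn.lt_or_eq with hn | hn
    · have h1 := hs n hn
      rw [hf] at h1
      refine ih (f (n + 1)).1 (f (n + 1)).2 h1 (n + 1) ?_ rfl
      exact_mod_cast Order.add_one_le_of_lt hn
    · obtain ⟨p₁, r₁, h⟩ := hex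
      exact absurd ⟨_, hf ▸ h⟩ (hmax n hn)

/-- A pair outside `MustWf` is unsuccessful and is either deadlocked or has a successor outside
`MustWf`; dependent choice yields a maximal computation without success. -/
theorem Must.mustWf {p r : Term Act K} (h : Must D co p r) : MustWf D co p r := by
  classical
  by_contra hb
  let Bad : Term Act K × Term Act K → Prop := fun c => ¬ MustWf D co c.1 c.2
  -- A deadlocked pair is repeated to make the sequence total; the computation is cut at the first
  -- deadlock.
  have hnext : ∀ c : {c // Bad c}, ∃ c' : {c // Bad c},
      (∃ d, ParStep D co c.1 (.move .tau) d) → ParStep D co c.1 (.move .tau) c'.1 := by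
    rintro ⟨c, hc⟩
    by_cases hex : ∃ d, ParStep D co c (.move .tau) d
    · obtain ⟨d, hd⟩ := hex
      obtain ⟨p₁, r₁, h₁, h₂⟩ := exists_parStep_of_not_mustWf hc ⟨d.1, d.2, hd⟩
      exact ⟨⟨(p₁, r₁), h₂⟩, fun _ => h₁⟩
    · exact ⟨⟨c, hc⟩, fun h => absurd h hex⟩
  choose nx hnx using hnext
  let c : ℕ → {c // Bad c} := fun n => Nat.rec ⟨(p, r), hb⟩ (fun _ c => nx c) n
  have hbad : ∀ k, ¬ ReportsOk D (c k).1.2 := fun k => notOk_of_not_mustWf (c k).2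
  by_cases hst : ∃ n, ¬ ∃ d, ParStep D co (c n).1 (.move .tau) d
  · have hmax : IsMaxComputation D co p r (Nat.find hst) fun n => (c n).1 := by
      refine ⟨rfl, fun n hn => ?_, fun n hn => ?_⟩
      · exact hnx (c n) (not_not.1 (Nat.find_min hst (by exact_mod_cast hn)))
      · obtain rfl : n = Nat.find hst := by exact_mod_cast hn
        exact Nat.find_spec hst
    obtain ⟨k, -, hk⟩ := h _ _ hmax
    exact hbad k hk
  · push Not at hst
    obtain ⟨k, -, hk⟩ := h ⊤ (fun n => (c n).1)
      ⟨rfl, fun n _ => hnx (c n) (hst n), fun n hn => absurd hn (ENat.natCast_ne_top n)⟩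
    exact hbad k hk

theorem must_iff {p r : Term Act K} : Must D co p r ↔ MustWf D co p r :=
  ⟨Must.mustWf, MustWf.must⟩

theorem parStep_swap (hco : Function.Involutive co) {c d : Term Act K × Term Act K}
    {l : Label Act} (h : ParStep D co c l d) : ParStep D co c.swap l d.swap := by
  cases h with
  | left _ _ _ _ h => exact .right _ _ _ _ h
  | right _ _ _ _ h => exact .left _ _ _ _ h
  | synch _ _ _ _ a h h' => exact .synch _ _ _ _ (co a) h' ((hco a).symm ▸ h)

theorem IsMaxComputation.swap (hco : Function.Involutive co) {p r : Term Act K} {N : ℕ∞}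
    {f : ℕ → Term Act K × Term Act K} (h : IsMaxComputation D co p r N f) :
    IsMaxComputation D co r p N fun n => (f n).swap := by
  obtain ⟨h0, hs, hm⟩ := h
  exact ⟨by simp [h0], fun n hn => parStep_swap hco (hs n hn),
    fun n hn ⟨c, hc⟩ => hm n hn ⟨c.swap, by simpa using parStep_swap hco hc⟩⟩

theorem mustPeer_iff (hco : Function.Involutive co) {p r : Term Act K} :
    MustPeer D co p r ↔ MustWf D co p r ∧ MustWf D co r p := by
  simp only [← must_iff]
  constructor
  · exact fun h => ⟨fun N f hf => (h N f hf).1, fun N f hf => by simpa using (h N _ (hf.swap hco)).2⟩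
  · exact fun h N f hf => ⟨h.1 N f hf, by simpa using h.2 N _ (hf.swap hco)⟩

theorem peerLE_iff (hco : Function.Involutive co) {p q : Term Act K} :
    PeerLE D co p q ↔ ∀ r, MustWf D co p r → MustWf D co r p →
      MustWf D co q r ∧ MustWf D co r q := by
  simp only [PeerLE, mustPeer_iff hco, and_imp]

/-! ### Convergence and trace-wise predicates -/

theorem converges_iff_acc {p : Term Act K} :
    Converges D p ↔ Acc (fun y x => Step D x (.move .tau) y) p := by
  rw [← not_iff_not, not_acc_iff_exists_descending_chain, Converges, not_not]

theorem Converges.of_step {p p₁ : Term Act K} (h : Converges D p)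
    (hs : Step D p (.move .tau) p₁) : Converges D p₁ :=
  converges_iff_acc.2 ((converges_iff_acc.1 h).inv hs)

theorem MustWf.converges {p r : Term Act K} (h : MustWf D co p r) (hr : NotOk D r) :
    Converges D p := by
  rw [converges_iff_acc]
  induction h with
  | ok h => exact absurd h hr
  | step _ _ ih => exact Acc.intro _ fun y hy => ih y _ (.left _ _ _ _ hy) hr

/-- With the server idle, an infinite silent run of the client must meet success. -/
theorem MustWf.acc_client {p r : Term Act K} (h : MustWf D co p r) :
    Acc (fun y x => NotOk D x ∧ Step D x (.move .tau) y) r := by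
  induction h with
  | ok h => exact Acc.intro _ fun y hy => absurd h hy.1
  | step _ _ ih => exact Acc.intro _ fun y hy => ih _ y (.right _ _ _ _ hy.2)

theorem GuardedWeak.exists_of_cons {G : Term Act K → Prop} {p q : Term Act K} {a : Act}
    {s : List Act} (h : GuardedWeak D G p (a :: s) q) :
    ∃ p₁ p₂, GuardedWeak D G p [] p₁ ∧ Step D p₁ (.move (.vis a)) p₂ ∧ GuardedWeak D G p₂ s q := by
  generalize hw : a :: s = w at h
  induction h with
  | refl _ => cases hw
  | vis hp h hq _ =>
    obtain ⟨rfl, rfl⟩ := List.cons.inj hw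
    exact ⟨_, _, .refl hp, h, hq⟩
  | tau hp h _ ih =>
    obtain ⟨p₁, p₂, h₁, h₂⟩ := ih hw
    exact ⟨p₁, p₂, .tau hp h h₁, h₂⟩

theorem MustWf.of_client_weak_nil {p r r' : Term Act K} (h : MustWf D co p r)
    (hr : GuardedWeak D (NotOk D) r [] r') : MustWf D co p r' := by
  generalize hs : ([] : List Act) = s at hr
  induction hr with
  | refl _ => exact h
  | vis _ _ _ _ => cases hs
  | tau hr h' _ ih => exact ih (h.of_step hr (.right _ _ _ _ h')) hs

/-- Zipping: complementary paths interleave into one computation, and as long as the client stays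
unsuccessful the obligation passes to the residuals. -/
theorem MustWf.of_weak {G : Term Act K → Prop} {p p' r r' : Term Act K} {s : List Act}
    (h : MustWf D co p r) (hp : GuardedWeak D G p s p')
    (hr : GuardedWeak D (NotOk D) r (s.map co) r') : MustWf D co p' r' := by
  induction hp generalizing r with
  | refl _ => exact h.of_client_weak_nil hr
  | vis _ hs _ ih =>
    obtain ⟨r₁, r₂, h₁, h₂, h₃⟩ := hr.exists_of_cons
    exact ih ((h.of_client_weak_nil h₁).of_step h₁.right_mem (.synch _ _ _ _ _ hs h₂)) h₃
  | tau _ hs _ ih => exact ih (h.of_step hr.left_mem (.left _ _ _ _ hs)) hr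

theorem map_map_co (hco : Function.Involutive co) (s : List Act) : (s.map co).map co = s := by
  simp [hco.comp_self]

theorem MustWf.of_weak' {G : Term Act K → Prop} (hco : Function.Involutive co)
    {p p' r r' : Term Act K} {s : List Act} (h : MustWf D co p r)
    (hp : GuardedWeak D G p (s.map co) p') (hr : GuardedWeak D (NotOk D) r s r') :
    MustWf D co p' r' :=
  h.of_weak hp ((map_map_co hco s).symm ▸ hr)

/-- Complementary infinite runs would interleave into an infinite unsuccessful computation. Each
step of the induction consumes a silent move of one side, or a synchronization when both are at
their next visible action. -/
theorem MustWf.false_of_infWeak {p r : Term Act K} {u : ℕ → Act} {G : Term Act K → Prop}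
    (h : MustWf D co p r) (hp : GuardedInfWeak D G p u)
    (hr : GuardedInfWeak D (NotOk D) r fun n => co (u n)) : False := by
  induction h generalizing u with
  | ok h => exact hr.step.1 h
  | step _ _ ih =>
    rcases hp.step.2 with ⟨p₁, h, hp₁⟩ | ⟨p₁, h, hp₁⟩
    · exact ih _ _ (.left _ _ _ _ h) hp₁ hr
    rcases hr.step.2 with ⟨r₁, h', hr₁⟩ | ⟨r₁, h', hr₁⟩
    · exact ih _ _ (.right _ _ _ _ h') hp hr₁
    · exact ih _ _ (.synch _ _ _ _ _ h h') hp₁ hr₁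

/-- The sum has only silent moves, each to a client that `t` satisfies; the one risk is that `t`
runs forever beforehand, and `t` converges because it serves an unsuccessful `x`. -/
theorem MustWf.intSum {t : Term Act K} {X : Set (Term Act K)} (hX : X.Countable)
    (hne : X.Nonempty) (hn : ∀ x ∈ X, NotOk D x) (h : ∀ x ∈ X, MustWf D co t x) :
    MustWf D co t (intSum X hX) := by
  obtain ⟨x, hx⟩ := hne
  have ht := converges_iff_acc.1 ((h x hx).converges (hn x hx))
  induction ht with
  | intro t _ ih =>
    refine .intro ⟨t, x, .right _ _ _ _ ((step_intSum_iff D X hX _ _).2 ⟨rfl, hx⟩)⟩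
      (fun t₁ ht₁ => ih t₁ ht₁ fun y hy => (h y hy).of_step (hn y hy) (.left _ _ _ _ ht₁))
      (fun y hy => h y ((step_intSum_iff D X hX _ _).1 hy).2)
      (fun a t₁ y _ hy => ?_)
    simp [step_intSum_iff] at hy

theorem mem_afterU {p q : Term Act K} {s : List Act} :
    q ∈ afterU D p s ↔ GuardedWeak D (NotOk D) p s q := uWeak_iff_guardedWeak

theorem mem_after {p q : Term Act K} {s : List Act} :
    q ∈ after D p s ↔ GuardedWeak D (fun _ => True) p s q := weak_iff_guardedWeak

/-- The unsuccessful residuals of the internal sum after `w` are those of `r` after `a :: w`, plus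
the sum itself when `w` is empty. -/
theorem usableAlong_iff {r : Term Act K} {s : List Act} :
    UsableAlong D co r s ↔
      ∀ w, w <+: s → ∃ t, ∀ q, GuardedWeak D (NotOk D) r w q → MustWf D co t q := by
  have hnil : ∀ r : Term Act K, Usable D co r ↔
      ∃ t, ∀ q, GuardedWeak D (NotOk D) r [] q → MustWf D co t q := by
    intro r
    constructor
    · rintro ⟨t, ht⟩
      exact ⟨t, fun q hq => ht.mustWf.of_client_weak_nil hq⟩
    · rintro ⟨t, ht⟩
      by_cases hr : ReportsOk D r
      · exact ⟨t, must_iff.2 (.ok hr)⟩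
      · exact ⟨t, must_iff.2 (ht r (.refl hr))⟩
  induction s generalizing r with
  | nil => simp [UsableAlong, hnil]
  | cons a s ih =>
    have hsum : ∀ w q, GuardedWeak D (NotOk D) r (a :: w) q ↔
        ∃ x ∈ afterU D r [a], GuardedWeak D (NotOk D) x w q := by
      intro w q
      simp only [mem_afterU]
      constructor
      · exact fun h => h.exists_of_append (s := [a])
      · rintro ⟨x, hx, h⟩
        exact hx.append h
    simp only [UsableAlong, hnil, ih, List.prefix_cons_iff]
    constructor
    · rintro ⟨h₀, h₁⟩ w (rfl | ⟨w, rfl, hw⟩)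
      · exact h₀
      · by_cases hne : ∃ q, UWeak D r [a] q
        · obtain ⟨t, ht⟩ := h₁ hne w hw
          refine ⟨t, fun q hq => ht q ?_⟩
          rw [guardedWeak_intSum_iff (notOk_intSum _ _)]
          exact .inr ((hsum _ _).1 hq)
        -- Without unsuccessful `a`-residuals any server works.
        · refine ⟨.unit, fun q hq => absurd ?_ hne⟩
          obtain ⟨x, hx, -⟩ := (hsum _ _).1 hq
          exact ⟨x, hx⟩
    · refine fun h => ⟨h [] (.inl rfl), fun hne w hw => ?_⟩
      obtain ⟨t, ht⟩ := h (a :: w) (.inr ⟨w, rfl, hw⟩)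
      refine ⟨t, fun q hq => ?_⟩
      rw [guardedWeak_intSum_iff (notOk_intSum _ _)] at hq
      rcases hq with ⟨rfl, rfl⟩ | hq
      · exact .intSum _ hne (fun x hx => (mem_afterU.1 hx).right_mem)
          fun x hx => ht x (mem_afterU.1 hx)
      · exact ht q ((hsum _ _).2 hq)

theorem converges_intSum_iff {X : Set (Term Act K)} (hX : X.Countable) :
    Converges D (intSum X hX) ↔ ∀ x ∈ X, Converges D x := by
  simp only [converges_iff_acc]
  constructor
  · exact fun h x hx => h.inv ((step_intSum_iff D X hX _ _).2 ⟨rfl, hx⟩)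
  · exact fun h => .intro _ fun x hx => h x ((step_intSum_iff D X hX _ _).1 hx).2

theorem convAlong_iff {p : Term Act K} {s : List Act} :
    ConvAlong D p s ↔
      ∀ w, w <+: s → ∀ q, GuardedWeak D (fun _ => True) p w q → Converges D q := by
  have hnil : ∀ p : Term Act K, Converges D p ↔
      ∀ q, GuardedWeak D (fun _ => True) p [] q → Converges D q := by
    intro p
    refine ⟨fun h q hq => ?_, fun h => h p (.refl trivial)⟩
    generalize hw : ([] : List Act) = w at hq
    induction hq with
    | refl _ => exact h
    | vis _ _ _ _ => cases hw
    | tau _ h' _ ih => exact ih (h.of_step h') hw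
  induction s generalizing p with
  | nil => simp [ConvAlong, ← hnil]
  | cons a s ih =>
    have hsum : ∀ w q, GuardedWeak D (fun _ => True) p (a :: w) q ↔
        ∃ x ∈ after D p [a], GuardedWeak D (fun _ => True) x w q := by
      intro w q
      simp only [mem_after]
      constructor
      · exact fun h => h.exists_of_append (s := [a])
      · rintro ⟨x, hx, h⟩
        exact hx.append h
    simp only [ConvAlong, ih, List.prefix_cons_iff]
    constructor
    · rintro ⟨h₀, h₁⟩ w (rfl | ⟨w, rfl, hw⟩) q hq
      · exact (hnil p).1 h₀ q hq
      · obtain ⟨x, hx, hq⟩ := (hsum _ _).1 hq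
        refine h₁ ⟨x, hx⟩ w hw q ?_
        rw [guardedWeak_intSum_iff trivial]
        exact .inr ⟨x, hx, hq⟩
    · refine fun h => ⟨(hnil p).2 (h [] (.inl rfl)), fun _ w hw q hq => ?_⟩
      rw [guardedWeak_intSum_iff trivial] at hq
      rcases hq with ⟨rfl, rfl⟩ | hq
      · rw [converges_intSum_iff]
        exact fun x hx => h [a] (.inr ⟨[], rfl, List.nil_prefix⟩) x (mem_after.1 hx)
      · exact h (a :: w) (.inr ⟨w, rfl, hw⟩) q ((hsum _ _).2 hq)

/-- For each prefix, a residual of `t` along the complementary prefix serves all unsuccessful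
residuals of `r` at once. -/
theorem usableAlong_of_mustWf {G : Term Act K → Prop} (hco : Function.Involutive co)
    {t t' r : Term Act K} {s : List Act} (h : MustWf D co t r)
    (ht : GuardedWeak D G t (s.map co) t') : UsableAlong D co r s := by
  rw [usableAlong_iff]
  intro w hw
  obtain ⟨m, hm⟩ := ht.exists_of_prefix (hw.map co)
  exact ⟨m, fun q hq => h.of_weak' hco hm hq⟩

theorem convAlong_of_mustWf {p r r' : Term Act K} {s : List Act} (h : MustWf D co p r)
    (hr : GuardedWeak D (NotOk D) r (s.map co) r') : ConvAlong D p s := by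
  rw [convAlong_iff]
  intro w hw q hq
  obtain ⟨m, hm⟩ := hr.exists_of_prefix (hw.map co)
  exact (h.of_weak hq hm).converges hm.right_mem

/-! ### Unzipping unsuccessful computations -/

/-- A convergent state from which no unsuccessful computation starts with a synchronization
either succeeds or reaches an unsuccessful deadlock. -/
theorem exists_deadlock_of_not_mustWf {p r : Term Act K} (h : ¬ MustWf D co p r)
    (hp : Converges D p) (hr : Acc (fun y x => NotOk D x ∧ Step D x (.move .tau) y) r)
    (hsyn : ∀ a p' r', GuardedWeak D (fun _ => True) p [a] p' →
      GuardedWeak D (NotOk D) r [co a] r' → MustWf D co p' r') :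
    ∃ p' r', GuardedWeak D (fun _ => True) p [] p' ∧ GuardedWeak D (NotOk D) r [] r' ∧
      ¬ ∃ p₁ r₁, ParStep D co (p', r') (.move .tau) (p₁, r₁) := by
  -- Nested well-founded induction: silent moves of the server outside, unsuccessful silent moves of
  -- the client inside.
  rw [converges_iff_acc] at hp
  induction hp generalizing r with
  | intro p _ ihp =>
    induction hr with
    | intro r hacc ihr =>
      have hok := notOk_of_not_mustWf h
      by_cases hex : ∃ p₁ r₁, ParStep D co (p, r) (.move .tau) (p₁, r₁)
      · obtain ⟨p₁, r₁, hs, h₁⟩ := exists_parStep_of_not_mustWf h hex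
        rcases parStep_tau_iff.1 hs with ⟨hl, rfl⟩ | ⟨rfl, hr⟩ | ⟨a, hl, hr⟩
        · obtain ⟨p', r', hp', h'⟩ := ihp p₁ hl h₁ (.intro _ hacc)
            fun a p' r' hp' hr' => hsyn a p' r' (.tau trivial hl hp') hr'
          exact ⟨p', r', .tau trivial hl hp', h'⟩
        · obtain ⟨p', r', hp', hr', h'⟩ := ihr r₁ ⟨hok, hr⟩ h₁
            fun a p' r' hp' hr' => hsyn a p' r' hp' (.tau hok hr hr')
          exact ⟨p', r', hp', .tau hok hr hr', h'⟩
        · exact absurd (hsyn a p₁ r₁ (.vis trivial hl (.refl trivial))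
            (.vis hok hr (.refl (notOk_of_not_mustWf h₁)))) h₁
      · exact ⟨p, r, .refl trivial, .refl hok, hex⟩

/-- An unsuccessful computation decomposes into traces of its two components. -/
theorem unzip {p r : Term Act K} (h : ¬ MustWf D co p r) :
    (∃ s p' r', GuardedWeak D (fun _ => True) p s p' ∧
      GuardedWeak D (NotOk D) r (s.map co) r' ∧
      (¬ Converges D p' ∨ ¬ Acc (fun y x => NotOk D x ∧ Step D x (.move .tau) y) r' ∨
        ¬ ∃ p₁ r₁, ParStep D co (p', r') (.move .tau) (p₁, r₁))) ∨
    ∃ u, GuardedInfWeak D (fun _ => True) p u ∧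
      GuardedInfWeak D (NotOk D) r fun n => co (u n) := by
  -- Either every failing pair reached can synchronize weakly into another failing pair, and
  -- iteration gives the infinite trace, or some failing pair cannot, and it diverges or reaches a
  -- deadlock.
  by_cases hall : ∀ s p' r', GuardedWeak D (fun _ => True) p s p' →
      GuardedWeak D (NotOk D) r (s.map co) r' → ¬ MustWf D co p' r' →
      ∃ a p₁ r₁, GuardedWeak D (fun _ => True) p' [a] p₁ ∧
        GuardedWeak D (NotOk D) r' [co a] r₁ ∧ ¬ MustWf D co p₁ r₁
  · right
    let Inv : Term Act K × Term Act K → Prop := fun c => ∃ s,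
      GuardedWeak D (fun _ => True) p s c.1 ∧ GuardedWeak D (NotOk D) r (s.map co) c.2 ∧
        ¬ MustWf D co c.1 c.2
    have hnext : ∀ c : {c // Inv c}, ∃ (a : Act) (c' : {c // Inv c}),
        GuardedWeak D (fun _ => True) c.1.1 [a] c'.1.1 ∧
        GuardedWeak D (NotOk D) c.1.2 [co a] c'.1.2 := by
      rintro ⟨⟨x, y⟩, s, hx, hy, hb⟩
      obtain ⟨a, x₁, y₁, hx₁, hy₁, hb₁⟩ := hall s x y hx hy hb
      exact ⟨a, ⟨(x₁, y₁), s ++ [a], hx.append hx₁, by simpa using hy.append hy₁, hb₁⟩, hx₁, hy₁⟩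
    choose a nx h₁ h₂ using hnext
    let c : ℕ → {c // Inv c} := fun n => Nat.rec
      ⟨(p, r), [], .refl trivial, .refl (notOk_of_not_mustWf h), h⟩ (fun _ c => nx c) n
    exact ⟨fun n => a (c n), guardedInfWeak_of_seq (g := fun n => (c n).1.1) fun n => h₁ (c n),
      guardedInfWeak_of_seq (g := fun n => (c n).1.2) fun n => h₂ (c n)⟩
  · left
    push Not at hall
    obtain ⟨s, p', r', hp, hr, hb, hsyn⟩ := hall
    by_cases hpc : Converges D p'
    · by_cases hrc : Acc (fun y x => NotOk D x ∧ Step D x (.move .tau) y) r'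
      · obtain ⟨p₂, r₂, hp₂, hr₂, h₂⟩ := exists_deadlock_of_not_mustWf hb hpc hrc hsyn
        exact ⟨s, p₂, r₂, by simpa using hp.append hp₂, by simpa using hr.append hr₂,
          .inr (.inr h₂)⟩
      · exact ⟨s, p', r', hp, hr, .inr (.inl hrc)⟩
    · exact ⟨s, p', r', hp, hr, .inl hpc⟩

/-! ### Soundness -/

theorem stable_of_deadlock {p r : Term Act K}
    (h : ¬ ∃ p₁ r₁, ParStep D co (p, r) (.move .tau) (p₁, r₁)) :
    Stable D p ∧ Stable D r ∧ ∀ a ∈ ready D p, co a ∉ ready D r :=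
  ⟨fun ⟨_, hs⟩ => h ⟨_, _, .left _ _ _ _ hs⟩, fun ⟨_, hs⟩ => h ⟨_, _, .right _ _ _ _ hs⟩,
    fun _ ⟨_, hs⟩ ⟨_, hs'⟩ => h ⟨_, _, .synch _ _ _ _ _ hs hs'⟩⟩

theorem deadlock_of_stable {p r : Term Act K} (hp : Stable D p) (hr : Stable D r)
    (h : ∀ a ∈ ready D p, co a ∉ ready D r) :
    ¬ ∃ p₁ r₁, ParStep D co (p, r) (.move .tau) (p₁, r₁) := by
  rintro ⟨p₁, r₁, hs⟩
  rcases parStep_tau_iff.1 hs with ⟨hs, -⟩ | ⟨-, hs⟩ | ⟨a, hs, hs'⟩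
  exacts [hp ⟨_, hs⟩, hr ⟨_, hs⟩, h a ⟨_, hs⟩ ⟨_, hs'⟩]

theorem mem_usableActions_of_mustWf {G : Term Act K → Prop} (hco : Function.Involutive co)
    {t t' r : Term Act K} {s : List Act} {a : Act} (h : MustWf D co t r)
    (ht : GuardedWeak D G t (s.map co) t') (ha : co a ∈ ready D t') :
    a ∈ usableActions D co r s := by
  obtain ⟨x, hx⟩ := ha
  intro _
  refine usableAlong_of_mustWf (G := fun _ => True) (t' := x) hco h ?_
  rw [List.map_append]
  exact ht.forget.append (.vis trivial hx (.refl trivial))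

/-- The semantic client preorder preserves the servers that satisfy a client. -/
theorem SemClientLE.mustWf (hco : Function.Involutive co) {p q r : Term Act K}
    (h : SemClientLE D co p q) (hr : MustWf D co r p) : MustWf D co r q := by
  by_contra hb
  rcases unzip hb with ⟨w, r', q', hr', hq', hcase⟩ | ⟨u, hru, hqu⟩
  · obtain ⟨s, rfl⟩ : ∃ s : List Act, w = s.map co := ⟨_, (map_map_co hco w).symm⟩
    rw [map_map_co hco] at hq'
    have hus := usableAlong_of_mustWf hco hr hr'
    rcases hcase with hc | hc | hc
    · obtain ⟨p', hp'⟩ := h.finTrace s hus ⟨q', uWeak_iff_guardedWeak.2 hq'⟩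
      rw [uWeak_iff_guardedWeak] at hp'
      exact hc ((hr.of_weak' hco hr' hp').converges hp'.right_mem)
    -- A client that diverges without success is not usable.
    · obtain ⟨t, ht⟩ := usableAlong_iff.1 (h.usable s hus) s List.prefix_rfl
      exact hc (ht q' hq').acc_client
    · obtain ⟨hst, hst', hsyn⟩ := stable_of_deadlock hc
      obtain ⟨A, ⟨p', hp', hps, rfl⟩, hA⟩ := h.accept s hus (ready D q')
        ⟨q', uWeak_iff_guardedWeak.2 hq', hst', rfl⟩
      rw [uWeak_iff_guardedWeak] at hp'
      -- The deadlock moves from `q'` to `p'`: an action on which `r'` could meet `p'` is usable,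
      -- hence already in the ready set of `q'`.
      refine deadlock_of_stable hst hps (fun a ha ha' => hsyn a ha (hA ⟨ha', ?_⟩))
        ((hr.of_weak' hco hr' hp').exists_step hp'.right_mem)
      exact mem_usableActions_of_mustWf hco hr hr' (by rwa [hco a])
  · refine hr.false_of_infWeak hru ?_
    have := h.infTrace _ (fun n => ?_) hqu
    · exact this
    · obtain ⟨r', hr'⟩ := hru.exists_initSeg n
      refine usableAlong_of_mustWf hco hr (G := fun _ => True) (t' := r') ?_
      simpa [map_initSeg, hco _] using hr'

/-- Peers that satisfy `p` as a client and are satisfied by it are satisfied by every `q` above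
`p` in the server-like preorder. -/
theorem SemUsableServerLE.mustWf (hco : Function.Involutive co) {p q r : Term Act K}
    (h : SemUsableServerLE D co p q) (hr : MustWf D co r p) (hp : MustWf D co p r) :
    MustWf D co q r := by
  by_contra hb
  have hconv : ∀ s r', GuardedWeak D (NotOk D) r (s.map co) r' → PeerConvAlong D co p s :=
    fun s r' hr' => ⟨convAlong_of_mustWf hp hr', usableAlong_of_mustWf hco hr hr'⟩
  rcases unzip hb with ⟨s, q', r', hq', hr', hcase⟩ | ⟨u, hqu, hru⟩
  · have hus := hconv s r' hr'
    rcases hcase with hc | hc | hc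
    · exact hc (convAlong_iff.1 (h.conv s hus) s List.prefix_rfl q' hq')
    · obtain ⟨p', hp'⟩ := h.finTrace s hus ⟨q', weak_iff_guardedWeak.2 hq'⟩
      rw [weak_iff_guardedWeak] at hp'
      exact hc (hp.of_weak hp' hr').acc_client
    · obtain ⟨hst, hst', hsyn⟩ := stable_of_deadlock hc
      obtain ⟨A, ⟨p', hp', hps, rfl⟩, hA⟩ := h.accept s hus (ready D q')
        ⟨q', weak_iff_guardedWeak.2 hq', hst, rfl⟩
      rw [weak_iff_guardedWeak] at hp'
      refine deadlock_of_stable hps hst' (fun a ha ha' => hsyn a (hA ⟨ha, ?_⟩) ha')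
        ((hp.of_weak hp' hr').exists_step hr'.right_mem)
      exact mem_usableActions_of_mustWf hco hr hr' ha'
  · refine hp.false_of_infWeak (infWeak_iff_guardedInfWeak.1 (h.infTrace u ?_
      (infWeak_iff_guardedInfWeak.2 hqu))) hru
    suffices ∀ n, PeerConvAlong D co p (initSeg u n) from ⟨fun n => (this n).1, fun n => (this n).2⟩
    intro n
    obtain ⟨r', hr'⟩ := hru.exists_initSeg n
    exact hconv _ r' (by rwa [map_initSeg])

theorem SemPeerLE.peerLE (hco : Function.Involutive co) {p q : Term Act K}
    (h : SemPeerLE D co p q) : PeerLE D co p q :=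
  (peerLE_iff hco).2 fun _ hp hr => ⟨h.2.mustWf hco hr hp, h.1.mustWf hco hr⟩

/-! ### Terms used in tests -/

namespace Term

theorem rename_rename {L M : Type*} (σ : K → L) (ρ : L → M) (p : Term Act K) :
    (p.rename σ).rename ρ = p.rename (ρ ∘ σ) := by
  induction p with
  | unit => rfl
  | const A => rfl
  | pre m p ih => simp only [rename, ih]
  | sum I p ih => simp only [rename, ih]

theorem rename_id (p : Term Act K) : p.rename id = p := by
  induction p with
  | unit => rfl
  | const A => rfl
  | pre m p ih => simp only [rename, ih]
  | sum I p ih => simp only [rename, ih]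

/-- Binary external choice. -/
def choice (p q : Term Act K) : Term Act K :=
  .sum Set.univ fun i => if i.1 = 0 then p else q

theorem rename_choice {L : Type*} (σ : K → L) (p q : Term Act K) :
    (p.choice q).rename σ = (p.rename σ).choice (q.rename σ) := by
  simp only [choice, rename, apply_ite (rename σ)]

end Term

theorem step_pre_iff {m : Move Act} {p q : Term Act K} {l : Label Act} :
    Step D (.pre m p) l q ↔ l = .move m ∧ q = p := by
  constructor
  · intro h
    cases h
    exact ⟨rfl, rfl⟩
  · rintro ⟨rfl, rfl⟩
    exact .pre _ _

theorem step_sum_iff {I : Set ℕ} {p : I → Term Act K} {q : Term Act K} {l : Label Act} :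
    Step D (.sum I p) l q ↔ ∃ i, Step D (p i) l q := by
  constructor
  · intro h
    cases h with
    | sum _ _ i _ _ h => exact ⟨i, h⟩
  · rintro ⟨i, h⟩
    exact .sum _ _ i _ _ h

theorem step_const_iff {A : K} {q : Term Act K} {l : Label Act} :
    Step D (.const A) l q ↔ Step D (D A) l q := by
  constructor
  · intro h
    cases h
    assumption
  · exact .const _ _ _

theorem step_choice_iff {p p' q : Term Act K} {l : Label Act} :
    Step D (p.choice p') l q ↔ Step D p l q ∨ Step D p' l q := by
  rw [Term.choice, step_sum_iff]
  constructor
  · rintro ⟨i, h⟩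
    split_ifs at h
    exacts [.inl h, .inr h]
  · rintro (h | h)
    · exact ⟨⟨0, trivial⟩, by simpa using h⟩
    · exact ⟨⟨1, trivial⟩, by simpa using h⟩

theorem exists_step_iff_of_countable {ι : Type*} {X : Set ι} (hX : X.Countable)
    (f : ι → Term Act K) :
    ∃ t, ∀ l q, Step D t l q ↔ ∃ x ∈ X, Step D (f x) l q := by
  obtain ⟨g, hg⟩ := Set.countable_iff_exists_injective.1 hX
  refine ⟨.sum (Set.range g) fun i => f (i.2.choose : X), fun l q => ?_⟩
  rw [step_sum_iff]
  constructor
  · rintro ⟨i, h⟩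
    exact ⟨_, Subtype.coe_prop _, h⟩
  · rintro ⟨x, hx, h⟩
    have hm : ∃ y, g y = g ⟨x, hx⟩ := ⟨_, rfl⟩
    refine ⟨⟨g ⟨x, hx⟩, hm⟩, ?_⟩
    have hc : hm.choose = ⟨x, hx⟩ := hg hm.choose_spec
    simpa only [hc] using h

theorem ready_countable (p : Term Act K) : (ready D p).Countable := by
  have hS : (⋃ n, transitionsUpTo D n p).Countable :=
    Set.countable_iUnion fun n => transitionsUpTo_countable D n p
  refine ((hS.image Prod.fst).preimage (f := fun a : Act => Label.move (.vis a)) ?_).mono ?_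
  · intro a b h
    simpa using h
  · rintro a ⟨q, h⟩
    obtain ⟨n, hn⟩ := h.exists_mem_transitionsUpTo
    exact ⟨_, Set.mem_iUnion.2 ⟨n, hn⟩, rfl⟩

/-- `t` can either retreat internally to `r` or perform `b` and continue as `t'`. -/
def IsStage (D : K → Term Act K) (t r : Term Act K) (b : Act) (t' : Term Act K) : Prop :=
  ∀ l q, Step D t l q ↔ (l = .move .tau ∧ q = r) ∨ (l = .move (.vis b) ∧ q = t')

theorem exists_isStage (r : Term Act K) (b : Act) (t' : Term Act K) : ∃ t, IsStage D t r b t' :=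
  ⟨(Term.pre .tau r).choice (.pre (.vis b) t'), fun l q => by
    rw [step_choice_iff, step_pre_iff, step_pre_iff]⟩

/-- An infinite chain of stages needs recursive definitions: the equation for stage `n` mentions the
unknown of stage `n + 1`. -/
theorem exists_isStage_seq (hD : DefinitionallyClosed D) (r : ℕ → Term Act K) (b : ℕ → Act) :
    ∃ t : ℕ → Term Act K, ∀ n, IsStage D (t n) (r n) (b n) (t (n + 1)) := by
  obtain ⟨A, hA⟩ := hD fun n => (Term.pre .tau ((r n).rename .inl)).choice
    (.pre (.vis (b n)) (.const (.inr (n + 1))))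
  refine ⟨fun n => .const (A n), fun n l q => ?_⟩
  rw [step_const_iff, hA, Term.rename_choice, step_choice_iff, Term.rename, Term.rename,
    Term.rename, Term.rename_rename, Sum.elim_comp_inl, Term.rename_id, step_pre_iff, step_pre_iff]
  rfl

theorem exists_loop (hD : DefinitionallyClosed D) :
    ∃ t : Term Act K, ∀ l q, Step D t l q ↔ l = .move .tau ∧ q = t := by
  obtain ⟨A, hA⟩ := hD fun _ => .pre .tau (.const (.inr 0))
  refine ⟨.const (A 0), fun l q => ?_⟩
  rw [step_const_iff, hA, Term.rename, step_pre_iff]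
  rfl

theorem IsStage.notOk {t r t' : Term Act K} {b : Act} (h : IsStage D t r b t') : NotOk D t := by
  rintro ⟨q, hq⟩
  simp [h _ _] at hq

theorem IsStage.weak {G : Term Act K → Prop} (hG : ∀ x, NotOk D x → G x) {t r t' : Term Act K}
    {b : Act} (h : IsStage D t r b t') (ht' : G t') : GuardedWeak D G t [b] t' :=
  .vis (hG t h.notOk) ((h _ _).2 (.inr ⟨rfl, rfl⟩)) (.refl ht')

theorem reportsOk_unit_choice (r : Term Act K) : ReportsOk D (Term.choice .unit r) :=
  ⟨_, step_choice_iff.2 (.inl .ok)⟩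

/-- Success of the server plays no role, so a summand `1` can be added to it or removed from it. -/
theorem MustWf.congr_server {t t' x : Term Act K} (h : MustWf D co t x)
    (ht : ∀ m q, Step D t' (.move m) q ↔ Step D t (.move m) q) : MustWf D co t' x := by
  induction h with
  | ok h => exact .ok h
  | @step t x hex hall ih =>
    refine .intro ?_ (fun t₁ h => hall _ _ (.left _ _ _ _ ((ht _ _).1 h)))
      (fun x₁ h => ih _ _ (.right _ _ _ _ h) ht)
      fun a t₁ x₁ h h' => hall _ _ (.synch _ _ _ _ a ((ht _ _).1 h) h')
    obtain ⟨t₁, x₁, h⟩ := hex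
    rcases parStep_tau_iff.1 h with ⟨h₁, rfl⟩ | ⟨rfl, h₁⟩ | ⟨a, h₁, h₂⟩
    · exact ⟨_, _, .left _ _ _ _ ((ht _ _).2 h₁)⟩
    · exact ⟨_, _, .right _ _ _ _ h₁⟩
    · exact ⟨_, _, .synch _ _ _ _ a ((ht _ _).2 h₁) h₂⟩

theorem step_unit_choice_iff {r q : Term Act K} {m : Move Act} :
    Step D (Term.choice .unit r) (.move m) q ↔ Step D r (.move m) q := by
  rw [step_choice_iff, or_iff_right]
  intro h
  cases h

theorem MustWf.unit_choice {t x : Term Act K} (h : MustWf D co t x) :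
    MustWf D co (Term.choice .unit t) x :=
  h.congr_server fun _ _ => step_unit_choice_iff

/-! ### Stages of tests -/

/-- While the stage waits, the client makes only silent moves, each descending in the derivation of
`MustWf D co r x`. Afterwards the stage has either retreated to `r` or synchronized on `a`. -/
theorem MustWf.of_isStage {t r t' x : Term Act K} {a : Act} (hco : Function.Involutive co)
    (ht : IsStage D t r (co a) t') (hr : MustWf D co r x)
    (ht' : ∀ x', GuardedWeak D (NotOk D) x [a] x' → MustWf D co t' x') : MustWf D co t x := by
  have hret : Step D t (.move .tau) r := (ht _ _).2 (.inl ⟨rfl, rfl⟩)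
  induction hr with
  | ok h => exact .ok h
  | @step r x _ _ ih =>
    by_cases hx : ReportsOk D x
    · exact .ok hx
    refine .intro ⟨r, x, .left _ _ _ _ hret⟩ (fun t₁ h => ?_) (fun x₁ h => ?_)
      fun b t₁ x₁ h h' => ?_
    · obtain ⟨-, rfl⟩ | ⟨h, -⟩ := (ht _ _).1 h
      · exact .step ‹_› ‹_›
      · cases h
    · exact ih r x₁ (.right _ _ _ _ h) ht (fun x' hx' => ht' x' (.tau hx h hx')) hret
    · obtain ⟨h, -⟩ | ⟨h, rfl⟩ := (ht _ _).1 h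
      · cases h
      · obtain rfl : b = co a := by simpa using h
        rw [hco a] at h'
        by_cases hx₁ : ReportsOk D x₁
        · exact .ok hx₁
        · exact ht' x₁ (.vis hx h' (.refl hx₁))

/-- The stage is now the client: retreating succeeds at once, and convergence of `x` keeps it from
postponing a move of the stage forever. -/
theorem mustWf_of_isStage {t r t' x : Term Act K} {a : Act} (hco : Function.Involutive co)
    (ht : IsStage D t r (co a) t') (hr : ReportsOk D r) (hx : Converges D x)
    (ht' : ∀ x', GuardedWeak D (fun _ => True) x [a] x' → MustWf D co x' t') :
    MustWf D co x t := by
  have hret : Step D t (.move .tau) r := (ht _ _).2 (.inl ⟨rfl, rfl⟩)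
  rw [converges_iff_acc] at hx
  induction hx with
  | intro x _ ih =>
    refine .intro ⟨x, r, .right _ _ _ _ hret⟩ (fun x₁ h => ?_) (fun t₁ h => ?_)
      fun b x₁ t₁ h' h => ?_
    · exact ih x₁ h fun x' hx' => ht' x' (.tau trivial h hx')
    · obtain ⟨-, rfl⟩ | ⟨h, -⟩ := (ht _ _).1 h
      · exact .ok hr
      · cases h
    · obtain ⟨h, -⟩ | ⟨h, rfl⟩ := (ht _ _).1 h
      · cases h
      · obtain rfl : b = a := hco.injective (by simpa using h)
        exact ht' x₁ (.vis trivial h' (.refl trivial))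

theorem MustWf.pre_tau {r x : Term Act K} (hr : MustWf D co r x) :
    MustWf D co (.pre .tau r) x := by
  induction hr with
  | ok h => exact .ok h
  | @step r x hex hall ih =>
    refine .intro ⟨r, x, .left _ _ _ _ (.pre _ _)⟩ (fun t₁ h => ?_)
      (fun x₁ h => ih r x₁ (.right _ _ _ _ h)) fun b t₁ x₁ h _ => ?_
    · obtain ⟨-, rfl⟩ := step_pre_iff.1 h
      exact .step hex hall
    · cases h

theorem mustWf_pre_tau {r x : Term Act K} (hr : ReportsOk D r) (hx : Converges D x) :
    MustWf D co x (.pre .tau r) := by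
  rw [converges_iff_acc] at hx
  induction hx with
  | intro x _ ih =>
    refine .intro ⟨x, r, .right _ _ _ _ (.pre _ _)⟩ ih (fun t₁ h => ?_) fun b x₁ t₁ _ h => ?_
    · obtain ⟨-, rfl⟩ := step_pre_iff.1 h
      exact .ok hr
    · cases h

theorem UsableAlong.exists_server {p : Term Act K} {s : List Act} (h : UsableAlong D co p s) :
    ∃ t, ∀ x, GuardedWeak D (NotOk D) p s x → MustWf D co t x :=
  usableAlong_iff.1 h s List.prefix_rfl

theorem UsableAlong.of_prefix {p : Term Act K} {s w : List Act} (h : UsableAlong D co p s)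
    (hw : w <+: s) : UsableAlong D co p w :=
  usableAlong_iff.2 fun v hv => usableAlong_iff.1 h v (hv.trans hw)

theorem ConvAlong.converges {p x : Term Act K} {s : List Act} (h : ConvAlong D p s)
    (hx : GuardedWeak D (fun _ => True) p s x) : Converges D x :=
  convAlong_iff.1 h s List.prefix_rfl x hx

theorem ConvAlong.of_prefix {p : Term Act K} {s w : List Act} (h : ConvAlong D p s)
    (hw : w <+: s) : ConvAlong D p w :=
  convAlong_iff.2 fun v hv => convAlong_iff.1 h v (hv.trans hw)

/-- A test that follows the trace `s` and then behaves like `t`. -/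
theorem exists_test (hco : Function.Involutive co) {p t : Term Act K} {s : List Act}
    (hus : UsableAlong D co p s)
    (ht : ∀ x, GuardedWeak D (NotOk D) p s x → MustWf D co t x) :
    ∃ T, MustWf D co T p ∧
      -- `G` is `NotOk` when the test is used as a client, and trivial when it is a server and `t`
      -- may report success.
      (∀ G : Term Act K → Prop, (∀ x, NotOk D x → G x) → G t → GuardedWeak D G T (s.map co) t) ∧
      (ConvAlong D p s → (∀ x, GuardedWeak D (fun _ => True) p s x → MustWf D co x t) →
        MustWf D co p T) := by
  induction s using List.reverseRecOn generalizing t with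
  | nil =>
    refine ⟨t, ?_, fun G _ hG => .refl hG, fun _ h => h p (.refl trivial)⟩
    by_cases hp : ReportsOk D p
    · exact .ok hp
    · exact ht p (.refl hp)
  | append_singleton s a ih =>
    have hpre : s <+: s ++ [a] := List.prefix_append _ _
    -- Induction from the end of the trace: a stage that retreats to `1 + r` and otherwise performs
    -- `co a` replaces `t` as the final part of the test for `s`.
    obtain ⟨r, hr⟩ := (hus.of_prefix hpre).exists_server
    obtain ⟨t', ht'⟩ := exists_isStage (D := D) (Term.choice .unit r) (co a) t
    obtain ⟨T, h₁, h₂, h₃⟩ := ih (hus.of_prefix hpre) (t := t') fun x hx =>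
      .of_isStage hco ht' (hr x hx).unit_choice fun x' hx' => ht x' (hx.append hx')
    refine ⟨T, h₁, fun G hG hGt => ?_, fun hc hx => h₃ (hc.of_prefix hpre) fun x hpx => ?_⟩
    · rw [List.map_append]
      exact (h₂ G hG (hG _ ht'.notOk)).append (ht'.weak hG hGt)
    · exact mustWf_of_isStage hco ht' (reportsOk_unit_choice r)
        ((hc.of_prefix hpre).converges hpx) fun x' hx' => hx x' (hpx.append hx')

theorem guardedInfWeak_of_invariant {G : Term Act K → Prop} {p : Term Act K} {u : ℕ → Act}
    (Inv : ℕ → Term Act K → Prop) (h0 : Inv 0 p)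
    (hs : ∀ n x, Inv n x → ∃ x', GuardedWeak D G x [u n] x' ∧ Inv (n + 1) x') :
    GuardedInfWeak D G p u := by
  choose nx h₁ h₂ using hs
  let c : (n : ℕ) → {x // Inv n x} := fun n =>
    Nat.rec ⟨p, h0⟩ (fun n c => ⟨nx n c.1 c.2, h₂ n c.1 c.2⟩) n
  exact guardedInfWeak_of_seq (g := fun n => (c n).1) fun n => h₁ n (c n).1 (c n).2

/-- A test that follows the infinite trace `u`. -/
theorem exists_infTest (hco : Function.Involutive co) (hD : DefinitionallyClosed D)
    {p : Term Act K} {u : ℕ → Act} (hus : InfUsableAlong D co p u) :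
    ∃ T, GuardedInfWeak D (NotOk D) T (fun n => co (u n)) ∧
      (¬ GuardedInfWeak D (NotOk D) p u → MustWf D co T p) ∧
      (InfConvAlong D p u → ¬ GuardedInfWeak D (fun _ => True) p u → MustWf D co p T) := by
  choose r hr using fun n => (hus n).exists_server
  obtain ⟨t, ht⟩ := exists_isStage_seq hD (fun n => Term.choice .unit (r n)) fun n => co (u n)
  refine ⟨t 0, guardedInfWeak_of_seq fun n => (ht n).weak (fun _ h => h) (ht (n + 1)).notOk,
    fun hp => ?_, fun hc hp => ?_⟩
  · by_contra hb
    -- A failing residual of `p` at stage `n` must perform `u n` into a failing residual at the next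
    -- stage, which builds the run of `p` along `u`.
    refine hp (guardedInfWeak_of_invariant
      (fun n x => GuardedWeak D (NotOk D) p (initSeg u n) x ∧ ¬ MustWf D co (t n) x)
      ⟨.refl (notOk_of_not_mustWf hb), hb⟩ fun n x ⟨hx, hxb⟩ => ?_)
    by_contra! hno
    refine hxb (.of_isStage hco (ht n) (hr n x hx).unit_choice fun x' hx' => ?_)
    have := hno x' hx'
    rw [initSeg_succ] at this
    exact this (hx.append hx')
  · by_contra hb
    refine hp (guardedInfWeak_of_invariant
      (fun n x => GuardedWeak D (fun _ => True) p (initSeg u n) x ∧ ¬ MustWf D co x (t n))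
      ⟨.refl trivial, hb⟩ fun n x ⟨hx, hxb⟩ => ?_)
    by_contra! hno
    refine hxb (mustWf_of_isStage hco (ht n) (reportsOk_unit_choice _) ((hc n).converges hx)
      fun x' hx' => ?_)
    have := hno x' hx'
    rw [initSeg_succ] at this
    exact this (hx.append hx')

/-- A test that offers the complements of a countable set `C` of usable actions. -/
theorem exists_offer (hco : Function.Involutive co) {p : Term Act K} {s : List Act}
    (hus : UsableAlong D co p s) {C : Set Act} (hC : C.Countable)
    (hua : C ⊆ usableActions D co p s) :
    ∃ t, NotOk D t ∧ Stable D t ∧ (∀ b ∈ ready D t, co b ∈ C) ∧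
      ((∀ x, GuardedWeak D (NotOk D) p s x → Stable D x → ∃ a ∈ C, a ∈ ready D x) →
        ∀ x, GuardedWeak D (NotOk D) p s x → MustWf D co t x) ∧
      (ConvAlong D p s →
        (∀ x, GuardedWeak D (fun _ => True) p s x → Stable D x → ∃ a ∈ C, a ∈ ready D x) →
        ∀ x, GuardedWeak D (fun _ => True) p s x → MustWf D co x t) := by
  -- Membership in `usableActions` gives a common server after `a`; if `p` cannot reach `a`
  -- unsuccessfully, any term will do.
  have hserver : ∀ a, ∃ r, a ∈ C →
      ∀ x, GuardedWeak D (NotOk D) p (s ++ [a]) x → MustWf D co r x := by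
    intro a
    by_cases ha : a ∈ C ∧ ∃ x, UWeak D p (s ++ [a]) x
    · obtain ⟨r, hr⟩ := (hua ha.1 ha.2).exists_server
      exact ⟨r, fun _ => hr⟩
    · exact ⟨.unit, fun haC x hx => absurd ⟨haC, x, uWeak_iff_guardedWeak.2 hx⟩ ha⟩
  choose r hr using hserver
  obtain ⟨t, ht⟩ := exists_step_iff_of_countable (D := D) hC
    fun a => .pre (.vis (co a)) (Term.choice .unit (r a))
  simp only [step_pre_iff] at ht
  have hvis : ∀ b q, Step D t (.move (.vis b)) q → co b ∈ C ∧ q = Term.choice .unit (r (co b)) := by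
    intro b q h
    obtain ⟨a, ha, hb, rfl⟩ := (ht _ _).1 h
    obtain rfl : b = co a := by simpa using hb
    rw [hco a]
    exact ⟨ha, rfl⟩
  have hoff : ∀ a ∈ C, Step D t (.move (.vis (co a))) (Term.choice .unit (r a)) :=
    fun a ha => (ht _ _).2 ⟨a, ha, rfl, rfl⟩
  have htau : ∀ q, ¬ Step D t (.move .tau) q := by
    intro q h
    obtain ⟨a, -, h, -⟩ := (ht _ _).1 h
    simp at h
  refine ⟨t, ?_, fun ⟨q, h⟩ => htau q h, fun b ⟨q, h⟩ => (hvis b q h).1, ?_, ?_⟩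
  · rintro ⟨q, h⟩
    obtain ⟨a, -, h, -⟩ := (ht _ _).1 h
    cases h
  · intro hready x hx
    -- The server `t₀` only shows that the unsuccessful silent moves of `x` are well-founded.
    obtain ⟨t₀, ht₀⟩ := hus.exists_server
    induction (ht₀ x hx).acc_client with
    | intro x _ ih =>
      refine .intro ?_ (fun t₁ h => absurd h (htau t₁)) (fun x₁ h => ?_) fun b t₁ x₁ h h' => ?_
      · by_cases hst : Stable D x
        · obtain ⟨a, ha, x₁, hax⟩ := hready x hx hst
          exact ⟨_, x₁, .synch _ _ _ _ (co a) (hoff a ha) ((hco a).symm ▸ hax)⟩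
        · obtain ⟨x₁, h⟩ := not_not.1 hst
          exact ⟨t, x₁, .right _ _ _ _ h⟩
      · by_cases hx₁ : ReportsOk D x₁
        · exact .ok hx₁
        · refine ih x₁ ⟨hx.right_mem, h⟩ ?_
          simpa using hx.append (.tau hx.right_mem h (.refl hx₁))
      · obtain ⟨hb, rfl⟩ := hvis b t₁ h
        by_cases hx₁ : ReportsOk D x₁
        · exact .ok hx₁
        · exact (hr _ hb x₁ (hx.append (.vis hx.right_mem h' (.refl hx₁)))).unit_choice
  · intro hc hready x hx
    induction converges_iff_acc.1 (hc.converges hx) with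
    | intro x _ ih =>
      refine .intro ?_ (fun x₁ h => ?_) (fun t₁ h => absurd h (htau t₁)) fun b x₁ t₁ h' h => ?_
      · by_cases hst : Stable D x
        · obtain ⟨a, ha, x₁, hax⟩ := hready x hx hst
          exact ⟨x₁, _, .synch _ _ _ _ a hax (hoff a ha)⟩
        · obtain ⟨x₁, h⟩ := not_not.1 hst
          exact ⟨x₁, t, .left _ _ _ _ h⟩
      · exact ih x₁ h (by simpa using hx.append (.tau trivial h (.refl trivial)))
      · obtain ⟨-, rfl⟩ := hvis _ t₁ h
        exact .ok (reportsOk_unit_choice _)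

/-! ### Completeness -/

/-- The peer `1 + r` succeeds as a client immediately, so only its role as a server is tested. -/
theorem PeerLE.mustWf_client (hco : Function.Involutive co) {p q r : Term Act K}
    (h : PeerLE D co p q) (hr : MustWf D co r p) : MustWf D co r q := by
  exact ((peerLE_iff hco).1 h _ (.ok (reportsOk_unit_choice r)) hr.unit_choice).2.congr_server
    fun _ _ => step_unit_choice_iff.symm

theorem not_mustWf_of_loop {t x : Term Act K} (ht : Step D t (.move .tau) t) (hx : NotOk D x) :
    ¬ MustWf D co t x :=
  fun h => h.converges hx ⟨fun _ => t, rfl, fun _ => ht⟩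

theorem not_mustWf_loop {t x : Term Act K} (ht : Step D t (.move .tau) t) (hok : NotOk D t) :
    ¬ MustWf D co x t :=
  fun h => not_acc_iff_exists_descending_chain.2 ⟨fun _ => t, rfl, fun _ => ⟨hok, ht⟩⟩ h.acc_client

/-- If no ready set of a stable state in `X` meets `U` within `B`, then countably many actions in
`U` and outside `B` suffice to engage every stable state in `X`. -/
theorem exists_refusal {S : Set (Set Act)} {B U : Set Act}
    {X : Set (Term Act K)} (hX : X.Countable) (hS : ∀ x ∈ X, Stable D x → ready D x ∈ S)
    (h : ∀ A ∈ S, ¬ A ∩ U ⊆ B) :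
    ∃ C : Set Act, C.Countable ∧ C ⊆ U ∧ Disjoint C B ∧
      ∀ x ∈ X, Stable D x → ∃ a ∈ C, a ∈ ready D x := by
  -- Countability of ready sets and of `X` lets the offer be written as a countable sum.
  refine ⟨((⋃ x ∈ X, ready D x) ∩ U) \ B, ?_, fun a ha => ha.1.2, Set.disjoint_sdiff_left,
    fun x hx hst => ?_⟩
  · exact (hX.biUnion fun x _ => ready_countable x).mono fun a ha => ha.1.1
  · obtain ⟨a, ⟨ha, haU⟩, haB⟩ := Set.not_subset.1 (h _ (hS x hx hst))
    exact ⟨a, ⟨⟨Set.mem_biUnion hx ha, haU⟩, haB⟩, ha⟩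

theorem PeerLE.semClientLE (hco : Function.Involutive co) (hD : DefinitionallyClosed D)
    {p q : Term Act K} (h : PeerLE D co p q) : SemClientLE D co p q where
  usable s hus := by
    rw [usableAlong_iff]
    intro w hw
    obtain ⟨t, ht⟩ := (hus.of_prefix hw).exists_server
    obtain ⟨T, hT, hTt, -⟩ := exists_test hco (hus.of_prefix hw) ht
    exact ⟨t, fun x hx => (h.mustWf_client hco hT).of_weak' hco
      (hTt (fun _ => True) (fun _ _ => trivial) trivial) hx⟩
  accept s hus B hB := by
    obtain ⟨q', hq', hst, rfl⟩ := hB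
    rw [uWeak_iff_guardedWeak] at hq'
    by_contra! hno
    obtain ⟨C, hC, hCU, hCB, hCr⟩ := exists_refusal (S := accU D p s) (afterU_countable D p s)
      (fun x hx hst => ⟨x, hx, hst, rfl⟩) hno
    obtain ⟨t, hok, htst, htC, ht, -⟩ := exists_offer hco hus hC hCU
    obtain ⟨T, hT, hTt, -⟩ := exists_test hco hus
      (ht fun x hx => hCr x (mem_afterU.2 hx))
    have hm := (h.mustWf_client hco hT).of_weak' hco
      (hTt (fun _ => True) (fun _ _ => trivial) trivial) hq'
    exact deadlock_of_stable htst hst (fun b hb hb' => Set.disjoint_left.1 hCB (htC b hb) hb')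
      (hm.exists_step hq'.right_mem)
  finTrace s hus hq := by
    obtain ⟨q', hq'⟩ := hq
    rw [uWeak_iff_guardedWeak] at hq'
    by_contra! hno
    -- As `p` has no unsuccessful residual after `s`, the test may end in anything; a silent loop
    -- serves no unsuccessful client.
    obtain ⟨t, ht⟩ := exists_loop hD
    obtain ⟨T, hT, hTt, -⟩ := exists_test (t := t) hco hus
      fun x hx => absurd (uWeak_iff_guardedWeak.2 hx) (hno x)
    exact not_mustWf_of_loop ((ht _ _).2 ⟨rfl, rfl⟩) hq'.right_mem
      ((h.mustWf_client hco hT).of_weak' hco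
        (hTt (fun _ => True) (fun _ _ => trivial) trivial) hq')
  infTrace u hus hq := by
    by_contra hno
    obtain ⟨T, hTu, hT, -⟩ := exists_infTest hco hD hus
    refine (h.mustWf_client hco (hT hno)).false_of_infWeak hTu ?_
    simp only [hco _]
    exact hq

theorem PeerLE.semUsableServerLE (hco : Function.Involutive co) (hD : DefinitionallyClosed D)
    {p q : Term Act K} (h : PeerLE D co p q) : SemUsableServerLE D co p q := by
  have hser : ∀ {r}, MustWf D co r p → MustWf D co p r → MustWf D co q r :=
    fun hr hp => ((peerLE_iff hco).1 h _ hp hr).1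
  refine ⟨?_, ?_, ?_, ?_⟩
  · rintro s ⟨hc, hus⟩
    rw [convAlong_iff]
    intro w hw x hx
    by_contra hdiv
    -- The test ends in `τ.(1 + r)`: one silent step short of success, so every converging server
    -- passes and a divergent one fails.
    obtain ⟨r, hr⟩ := (hus.of_prefix hw).exists_server
    have hok : NotOk D (.pre .tau (Term.choice .unit r)) := by
      rintro ⟨y, hy⟩
      cases hy
    obtain ⟨T, hT, hTt, hpT⟩ := exists_test hco (hus.of_prefix hw)
      fun y hy => (hr y hy).unit_choice.pre_tau
    have hc' := hc.of_prefix hw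
    have hm := (hser hT (hpT hc' fun y hy => mustWf_pre_tau (reportsOk_unit_choice r)
      (hc'.converges hy))).of_weak hx (hTt _ (fun _ h => h) hok)
    exact hdiv (hm.converges hok)
  · rintro s ⟨hc, hus⟩ _ ⟨q', hq', hst, rfl⟩
    rw [weak_iff_guardedWeak] at hq'
    by_contra! hno
    -- All residuals of `p` are taken here, successful paths included, so the same `C` engages `p`
    -- both as server and as client.
    obtain ⟨C, hC, hCU, hCB, hCr⟩ := exists_refusal (S := acc D p s) (after_countable D p s)
      (fun x hx hst => ⟨x, hx, hst, rfl⟩) hno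
    obtain ⟨t, hok, htst, htC, ht, ht'⟩ := exists_offer hco hus hC hCU
    obtain ⟨T, hT, hTt, hpT⟩ := exists_test hco hus
      (ht fun x hx => hCr x (mem_after.2 hx.forget))
    have hm := (hser hT (hpT hc (ht' hc fun x hx => hCr x (mem_after.2 hx)))).of_weak hq'
      (hTt _ (fun _ h => h) hok)
    refine deadlock_of_stable hst htst (fun a ha ha' => ?_) (hm.exists_step hok)
    exact Set.disjoint_left.1 hCB (hco a ▸ htC _ ha') ha
  · rintro s ⟨hc, hus⟩ ⟨q', hq'⟩
    rw [weak_iff_guardedWeak] at hq'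
    by_contra! hno
    simp only [weak_iff_guardedWeak] at hno
    -- As a client the loop never succeeds, and `p` never reaches it because it lacks the trace `s`.
    obtain ⟨t, ht⟩ := exists_loop hD
    have hok : NotOk D t := by
      rintro ⟨x, hx⟩
      simp [ht _ _] at hx
    obtain ⟨T, hT, hTt, hpT⟩ := exists_test (t := t) hco hus
      fun x hx => absurd hx.forget (hno x)
    exact not_mustWf_loop ((ht _ _).2 ⟨rfl, rfl⟩) hok
      ((hser hT (hpT hc fun x hx => absurd hx (hno x))).of_weak hq' (hTt _ (fun _ h => h) hok))
  · rintro u ⟨hc, hus⟩ hq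
    rw [infWeak_iff_guardedInfWeak] at hq ⊢
    by_contra hno
    obtain ⟨T, hTu, hT, hpT⟩ := exists_infTest hco hD hus
    refine (hser (hT fun hp => hno ?_) (hpT hc hno)).false_of_infWeak hq hTu
    obtain ⟨f, t, hf, -⟩ := hp
    exact ⟨f, t, hf, fun _ => trivial⟩

end PeerTesting

theorem mainTheorem2 {Act : Type*} {K : Type*} (co : Act → Act) (hco : Function.Involutive co)
    (D : K → Term Act K) (hD : DefinitionallyClosed D) (p q : Term Act K) :
    PeerLE D co p q ↔ SemPeerLE D co p q :=
  ⟨fun h => ⟨h.semClientLE hco hD, h.semUsableServerLE hco hD⟩, fun h => h.peerLE hco⟩
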